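/- Let $\tilde P=(\mathbb Z,\preccurlyeq)$ be an affine poset of order $n\ge 1$, that is, a partial order on $\mathbb Z$ such that $i\prec i+n$ for all $i$; $i\preccurlyeq j\iff i+n\preccurlyeq j+n$ for all $i,j$; and for all $i,j$ there is $k\in\mathbb N$ with $i\preccurlyeq j+kn$. Write $i\lessdot j$ for its cover relations and $H(\tilde P)$ for its Hasse diagram. *Affine piping complex.* The class of a subset $J\subseteq\mathbb Z$ is $[J]=\{J+kn : k\in\mathbb Z\}$. A pipe is a set $Q\subseteq\mathbb Z$ with $|Q|>1$ that is order convex, induces a connected subgraph of $H(\tilde P)$, and is thin (either $Q=\mathbb Z$, or $Q$ contains at most one element of each residue class modulo $n$). A pipe class is the class of a pipe; two pipe classes $[Q],[Q']$ are nested if $Q+kn\subseteq Q'$ or $Q'\subseteq Q+kn$ for some $k\in\mathbb Z$, and disjoint if $(Q+kn)\cap Q'=\varnothing$ for all $k\in\mathbb Z$. A piping is a set of pairwise nested or disjoint pipe classes containing $[\mathbb Z]$ and such that the directed graph whose vertices are all members of these classes, with an arc $Q\to R$ whenever $Q\cap R=\varnothing$ and $q\prec r$ for some $q\in Q$, $r\in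 R$, has no directed cycle. The faces of the affine piping complex of $\tilde P$ are the sets $\Pi\setminus\{[\mathbb Z]\}$ for all pipings $\Pi$. *Affine poset oriented building set.* Let $E$ be the set of cover relation classes $[i\lessdot j]=\{i+kn\lessdot j+kn : k\in\mathbb Z\}$. Let $(\mathbf b_0,\dots,\mathbf b_n)$ be the standard basis of $\mathbb R^{n+1}$, and for $j=qn+r$ with $0\le r<n$ put $\tilde{\mathbf b}_j=\mathbf b_r+q\,\mathbf b_n$. Let $\mathcal M$ be the oriented matroid on $E$ of the vector configuration $\mathbf a_{[i\lessdot j]}=\tilde{\mathbf b}_i-\tilde{\mathbf b}_j\in\mathbb R^{n+1}$; its circuits are the support-minimal signatures $c=(c_+,c_-)$ of nonzero linear dependences. The line graph $L$ has vertex set $E$, two distinct classes $[i\lessdot j]$, $[i'\lessdot j']$ being adjacent when one of $i,j$ is congruent modulo $n$ to one of $i',j'$. A building set on $E$ is a set of nonempty subsets of $E$ (blocks) that contains all singletons and contains $B\cup B'$ whenever it contains $B,B'$ with $B\cap B'\neq\varnothing$. Let $\mathcal B$ be the smallest building set on $E$ containing all nonempty subsets of $E$ that induce a connected subgraph of $L$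 and all supports $c_+\cup c_-$ of circuits $c$ of $\mathcal M$. *Acyclic nested complex.* Let $\kappa(\mathcal B)$ be the set of inclusion-maximal blocks. A nested set is a set $\mathcal N$ with $\kappa(\mathcal B)\subseteq\mathcal N\subseteq\mathcal B$ whose members are pairwise nested or disjoint and such that the union of any $k\ge2$ pairwise disjoint members of $\mathcal N$ is not in $\mathcal B$. It is acyclic if there are no circuit $c$ of $\mathcal M$ and subset $\mathcal N'\subseteq\mathcal N$ with $c_-\subseteq\bigcup\mathcal N'$ and $c_+\not\subseteq\bigcup\mathcal N'$. The faces of the acyclic nested complex of $(\mathcal B,\mathcal M)$ are the sets $\mathcal N\setminus\kappa(\mathcal B)$ for all acyclic nested sets $\mathcal N$. **Proposition.** For every affine poset $\tilde P$, the affine piping complex of $\tilde P$ is isomorphic, as a simplicial complex, to the acyclic nested complex of $(\mathcal B,\mathcal M)$: there is a bijection between their vertices under which faces correspond to faces in both directions. -/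

import Mathlib

/-! ## Simplicial complexes -/

/-- An abstract simplicial complex on a vertex type: a family of finite sets closed under taking
subsets. The empty set is allowed as a face, so that the complex `{∅}` and the empty complex are
different. -/
structure SimpComplex (V : Type*) where
  faces : Set (Finset V)
  down_closed : ∀ ⦃s t : Finset V⦄, s ∈ faces → t ⊆ s → t ∈ faces

/-- The vertices of a simplicial complex are the points `v` such that `{v}` is a face. -/
def SimpComplex.vertices {V : Type*} (K : SimpComplex V) : Set V := {v | {v} ∈ K.faces}

/-- An isomorphism of simplicial complexes: a bijection between the vertex sets such that a finite
set of vertices is a face if and only if its image is a face. -/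
structure SimpComplex.Iso {V W : Type*} (K : SimpComplex V) (L : SimpComplex W) where
  toEquiv : K.vertices ≃ L.vertices
  map_faces : ∀ s : Finset K.vertices,
    s.map (Function.Embedding.subtype _) ∈ K.faces ↔
      (s.map toEquiv.toEmbedding).map (Function.Embedding.subtype _) ∈ L.faces

/-! ## Building sets -/

/-- A building set on the ground set `E`. -/
structure BuildingSet (E : Type*) where
  blocks : Set (Set E)
  nonempty_of_mem : ∀ B ∈ blocks, B.Nonempty
  singleton_mem : ∀ s : E, {s} ∈ blocks
  union_mem : ∀ B ∈ blocks, ∀ B' ∈ blocks, (B ∩ B').Nonempty → B ∪ B' ∈ blocks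

/-- The connected components of a building set: its inclusion maximal blocks. -/
def BuildingSet.components {E : Type*} (𝓑 : BuildingSet E) : Set (Set E) :=
  {B | B ∈ 𝓑.blocks ∧ ∀ B' ∈ 𝓑.blocks, B ⊆ B' → B' = B}

/-- The building closure of a family `X` of nonempty subsets of `E`: the smallest building set
containing `X`. -/
def buildingClosure {E : Type*} (X : Set (Set E)) : BuildingSet E where
  blocks := {B | B.Nonempty ∧ ∀ 𝓑 : BuildingSet E, X ⊆ 𝓑.blocks → B ∈ 𝓑.blocks}
  nonempty_of_mem _ hB := hB.1
  singleton_mem s := ⟨Set.singleton_nonempty s, fun 𝓑 _ => 𝓑.singleton_mem s⟩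
  union_mem B hB B' hB' h :=
    ⟨hB.1.mono Set.subset_union_left,
      fun 𝓑 hX => 𝓑.union_mem B (hB.2 𝓑 hX) B' (hB'.2 𝓑 hX) h⟩

/-- The tubes of a graph: the nonempty vertex sets that induce a connected subgraph. They are the
blocks of the graphical building set. -/
def graphTubes {E : Type*} (G : SimpleGraph E) : Set (Set E) :=
  {T | T.Nonempty ∧ (G.induce T).Connected}

/-- Nested sets on a building set. -/
structure BuildingSet.IsNested {E : Type*} (𝓑 : BuildingSet E) (N : Set (Set E)) : Prop where
  subset_blocks : N ⊆ 𝓑.blocks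
  components_subset : 𝓑.components ⊆ N
  nested_or_disjoint : ∀ B ∈ N, ∀ B' ∈ N, B ⊆ B' ∨ B' ⊆ B ∨ B ∩ B' = ∅
  union_notMem : ∀ M ⊆ N, M.Finite → M.Nontrivial → M.PairwiseDisjoint id → ⋃₀ M ∉ 𝓑.blocks

/-! ## Oriented matroids -/

/-- Signed subsets of `E`. -/
@[ext]
structure SignedSubset (E : Type*) where
  pos : Set E
  neg : Set E
  disj : Disjoint pos neg

/-- The support of a signed subset. -/
def SignedSubset.support {E : Type*} (x : SignedSubset E) : Set E := x.pos ∪ x.neg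

/-- The opposite of a signed subset. -/
def SignedSubset.opp {E : Type*} (x : SignedSubset E) : SignedSubset E :=
  ⟨x.neg, x.pos, x.disj.symm⟩

/-- An oriented matroid on `E`, given by its signed circuits. -/
structure OrMatroid (E : Type*) where
  circuits : Set (SignedSubset E)
  support_nonempty : ∀ c ∈ circuits, c.support.Nonempty
  opp_mem : ∀ c ∈ circuits, c.opp ∈ circuits
  incomparable : ∀ c ∈ circuits, ∀ c' ∈ circuits, c.support ⊆ c'.support → c = c' ∨ c = c'.opp
  elimination : ∀ c ∈ circuits, ∀ c' ∈ circuits, c ≠ c'.opp → ∀ s ∈ c.pos ∩ c'.neg,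
    ∃ c'' ∈ circuits, c''.pos ⊆ (c.pos ∪ c'.pos) \ {s} ∧ c''.neg ⊆ (c.neg ∪ c'.neg) \ {s}

/-- The signature of a real vector indexed by `E`. -/
def signature {E : Type*} (δ : E →₀ ℝ) : SignedSubset E where
  pos := {s | 0 < δ s}
  neg := {s | δ s < 0}
  disj := Set.disjoint_left.2 fun s (h : 0 < δ s) (h' : δ s < 0) => lt_asymm h h'

section VectorConfiguration

variable {E V : Type*} [AddCommGroup V] [Module ℝ V]

/-- The vectors of a vector configuration `A`: the signatures of its linear dependences. -/
def configVectors (A : E → V) : Set (SignedSubset E) :=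
  {v | ∃ δ : E →₀ ℝ, Finsupp.linearCombination ℝ A δ = 0 ∧ signature δ = v}

/-- The circuits of a vector configuration `A`: the support minimal signatures of its nonzero
linear dependences. -/
def configCircuits (A : E → V) : Set (SignedSubset E) :=
  {c | c ∈ configVectors A ∧ c.support.Nonempty ∧
    ∀ v ∈ configVectors A, v.support.Nonempty → v.support ⊆ c.support → v.support = c.support}

theorem mem_support_signature (δ : E →₀ ℝ) (s : E) : s ∈ (signature δ).support ↔ δ s ≠ 0 := by
  simp only [SignedSubset.support, signature, Set.mem_union, Set.mem_ofPred_eq]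
  constructor
  · rintro (h | h)
    · exact h.ne'
    · exact h.ne
  · intro h
    rcases lt_or_gt_of_ne h with h | h
    · exact Or.inr h
    · exact Or.inl h

theorem signature_neg (δ : E →₀ ℝ) : signature (-δ) = (signature δ).opp := by
  ext s <;> simp [signature, SignedSubset.opp]

/-- Every nonzero linear dependence has a circuit that conforms to its signs. -/
theorem exists_conformal_circuit (A : E → V) :
    ∀ (m : ℕ) (w : E →₀ ℝ), w.support.card ≤ m → Finsupp.linearCombination ℝ A w = 0 → w ≠ 0 →
      ∃ c ∈ configCircuits A, c.pos ⊆ (signature w).pos ∧ c.neg ⊆ (signature w).neg := by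
  intro m
  induction m with
  | zero =>
    intro w hm _ h0
    exact absurd (Finsupp.support_eq_empty.1 (Finset.card_eq_zero.1 (Nat.le_zero.1 hm))) h0
  | succ m ih =>
    intro w hm hw h0
    by_cases hmin : signature w ∈ configCircuits A
    · exact ⟨_, hmin, subset_rfl, subset_rfl⟩
    have hne : (signature w).support.Nonempty := by
      obtain ⟨s, hs⟩ := Finsupp.ne_iff.1 h0
      exact ⟨s, (mem_support_signature w s).2 hs⟩
    have key : ∃ u : E →₀ ℝ, Finsupp.linearCombination ℝ A u = 0 ∧ (∃ e, 0 < w e * u e) ∧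
        (∀ s, u s ≠ 0 → w s ≠ 0) ∧ ∃ s, w s ≠ 0 ∧ u s = 0 := by
      have : ∃ v ∈ configVectors A, v.support.Nonempty ∧ v.support ⊆ (signature w).support ∧
          v.support ≠ (signature w).support := by
        by_contra hcon
        push Not at hcon
        exact hmin ⟨⟨w, hw, rfl⟩, hne, fun v hv h1 h2 => hcon v hv h1 h2⟩
      obtain ⟨_, ⟨u, hu, rfl⟩, ⟨e, he⟩, hsub, hneq⟩ := this
      have hsub' : ∀ s, u s ≠ 0 → w s ≠ 0 := fun s hs =>
        (mem_support_signature w s).1 (hsub ((mem_support_signature u s).2 hs))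
      have hs : ∃ s, w s ≠ 0 ∧ u s = 0 := by
        by_contra hcon
        push Not at hcon
        refine hneq (Set.Subset.antisymm hsub fun s hs => ?_)
        exact (mem_support_signature u s).2 (hcon s ((mem_support_signature w s).1 hs))
      have hue := (mem_support_signature u e).1 he
      rcases lt_or_gt_of_ne (mul_ne_zero (hsub' e hue) hue) with h | h
      · refine ⟨-u, by simp [hu], ⟨e, by simpa using h⟩, ?_, ?_⟩
        · intro s hs
          exact hsub' s (by simpa using hs)
        · obtain ⟨s, h1, h2⟩ := hs
          exact ⟨s, h1, by simp [h2]⟩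
      · exact ⟨u, hu, ⟨e, h⟩, hsub', hs⟩
    obtain ⟨u, hu, ⟨e, he⟩, hsub, s₀, hws₀, hus₀⟩ := key
    let F : Finset E := w.support.filter fun s => 0 < w s * u s
    have heF : e ∈ F := by
      simp only [F, Finset.mem_filter, Finsupp.mem_support_iff]
      exact ⟨left_ne_zero_of_mul he.ne', he⟩
    obtain ⟨f, hfF, hf⟩ := F.exists_min_image (fun s => w s / u s) ⟨e, heF⟩
    have hfpos : 0 < w f * u f := (Finset.mem_filter.1 hfF).2
    have huf : u f ≠ 0 := right_ne_zero_of_mul hfpos.ne'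
    have ht : 0 < w f / u f := by
      rcases pos_and_pos_or_neg_and_neg_of_mul_pos hfpos with h | h
      · exact div_pos h.1 h.2
      · exact div_pos_of_neg_of_neg h.1 h.2
    set t := w f / u f with htdef
    have hconf : ∀ s, (0 < (w - t • u) s → 0 < w s) ∧ ((w - t • u) s < 0 → w s < 0) := by
      intro s
      simp only [Finsupp.sub_apply, Finsupp.smul_apply, smul_eq_mul]
      by_cases hus : u s = 0
      · simp [hus]
      have hws := hsub s hus
      by_cases hp : 0 < w s * u s
      · have hle : t ≤ w s / u s := hf s (by
          simp only [F, Finset.mem_filter, Finsupp.mem_support_iff]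
          exact ⟨hws, hp⟩)
        rcases pos_and_pos_or_neg_and_neg_of_mul_pos hp with h | h
        · have := (le_div_iff₀ h.2).1 hle
          exact ⟨fun _ => h.1, fun h' => by linarith⟩
        · have := (le_div_iff_of_neg h.2).1 hle
          exact ⟨fun h' => by linarith, fun _ => h.1⟩
      · have hn : w s * u s < 0 := lt_of_le_of_ne (not_lt.1 hp) (mul_ne_zero hws hus)
        rcases mul_neg_iff.1 hn with h | h
        · have := mul_neg_of_pos_of_neg ht h.2
          exact ⟨fun _ => h.1, fun h' => by linarith⟩
        · have := mul_pos ht h.2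
          exact ⟨fun h' => by linarith, fun _ => h.1⟩
    have hw'0 : w - t • u ≠ 0 := by
      intro h
      have := DFunLike.congr_fun h s₀
      simp [hus₀] at this
      exact hws₀ this
    have hsupp : (w - t • u).support ⊂ w.support := by
      rw [Finset.ssubset_iff_of_subset]
      · refine ⟨f, Finsupp.mem_support_iff.2 (left_ne_zero_of_mul hfpos.ne'), ?_⟩
        simp [htdef, huf]
      · intro s hs
        rw [Finsupp.mem_support_iff] at hs ⊢
        rcases lt_or_gt_of_ne hs with h | h
        · exact ((hconf s).2 h).ne
        · exact ((hconf s).1 h).ne'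
    obtain ⟨c, hc, hp, hn⟩ := ih (w - t • u)
      (by have := Finset.card_lt_card hsupp; omega) (by simp [hw, hu]) hw'0
    exact ⟨c, hc, fun s hs => (hconf s).1 (hp hs), fun s hs => (hconf s).2 (hn hs)⟩

/-- The oriented matroid of a vector configuration. -/
def configMatroid (A : E → V) : OrMatroid E where
  circuits := configCircuits A
  support_nonempty _ hc := hc.2.1
  opp_mem := by
    have hs : ∀ c : SignedSubset E, c.opp.support = c.support := fun c => Set.union_comm _ _
    rintro _ ⟨⟨δ, hδ, rfl⟩, hne, hmin⟩
    refine ⟨⟨-δ, by simp [hδ], signature_neg δ⟩, ?_, ?_⟩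
    · rwa [hs]
    · rwa [hs]
  incomparable := by
    rintro _ ⟨⟨δ, hδ, rfl⟩, hne, -⟩ _ ⟨⟨δ', hδ', rfl⟩, hne', hmin'⟩ hsub
    have heq := hmin' _ ⟨δ, hδ, rfl⟩ hne hsub
    obtain ⟨e, he⟩ := hne
    have hδe := (mem_support_signature δ e).1 he
    have hδ'e := (mem_support_signature δ' e).1 (hsub he)
    have hzero : δ' e • δ - δ e • δ' = 0 := by
      by_contra hcon
      have h1 : (signature (δ' e • δ - δ e • δ')).support = (signature δ').support := by
        refine hmin' _ ⟨δ' e • δ - δ e • δ', by simp [hδ, hδ'], rfl⟩ ?_ ?_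
        · obtain ⟨s, hs⟩ := Finsupp.ne_iff.1 hcon
          exact ⟨s, (mem_support_signature _ s).2 hs⟩
        · intro s hs
          by_contra hs'
          have h2 : δ' s = 0 := by
            by_contra h
            exact hs' ((mem_support_signature _ s).2 h)
          have h3 : δ s = 0 := by
            by_contra h
            exact hs' (hsub ((mem_support_signature _ s).2 h))
          exact (mem_support_signature _ s).1 hs (by simp [h2, h3])
      have h2 : e ∈ (signature (δ' e • δ - δ e • δ')).support := h1 ▸ hsub he
      exact (mem_support_signature _ e).1 h2 (by simp [mul_comm])
    have hval : ∀ s, δ s = (δ e / δ' e) * δ' s := by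
      intro s
      have := DFunLike.congr_fun hzero s
      simp at this
      field_simp
      linarith
    rcases lt_or_gt_of_ne (div_ne_zero hδe hδ'e) with h | h
    · right
      ext s
      · simp only [signature, SignedSubset.opp, Set.mem_ofPred_eq]
        rw [hval s]
        exact ⟨fun h' => by by_contra h2; nlinarith, fun h' => mul_pos_of_neg_of_neg h h'⟩
      · simp only [signature, SignedSubset.opp, Set.mem_ofPred_eq]
        rw [hval s]
        exact ⟨fun h' => by by_contra h2; nlinarith, fun h' => mul_neg_of_neg_of_pos h h'⟩
    · left
      ext s
      · simp only [signature, Set.mem_ofPred_eq]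
        rw [hval s, mul_pos_iff_of_pos_left h]
      · simp only [signature, Set.mem_ofPred_eq]
        rw [hval s]
        exact ⟨fun h' => by by_contra h2; nlinarith, fun h' => mul_neg_of_pos_of_neg h h'⟩
  elimination := by
    rintro _ ⟨⟨δ, hδ, rfl⟩, -, -⟩ _ ⟨⟨δ', hδ', rfl⟩, -, -⟩ hneq s ⟨hs, hs'⟩
    replace hs : 0 < δ s := hs
    replace hs' : δ' s < 0 := hs'
    have hw0 : (-δ' s) • δ + δ s • δ' ≠ 0 := by
      intro h
      have hval : ∀ e, δ' s * δ e = δ s * δ' e := by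
        intro e
        have := DFunLike.congr_fun h e
        simp at this
        linarith
      apply hneq
      ext e
      · have := hval e
        simp only [signature, SignedSubset.opp, Set.mem_ofPred_eq]
        exact ⟨fun h' => by by_contra h2; nlinarith, fun h' => by by_contra h2; nlinarith⟩
      · have := hval e
        simp only [signature, SignedSubset.opp, Set.mem_ofPred_eq]
        exact ⟨fun h' => by by_contra h2; nlinarith, fun h' => by by_contra h2; nlinarith⟩
    obtain ⟨c, hc, hp, hn⟩ := exists_conformal_circuit A _ ((-δ' s) • δ + δ s • δ') le_rfl
      (by simp [hδ, hδ']) hw0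
    refine ⟨c, hc, fun e he => ?_, fun e he => ?_⟩
    · have h : 0 < -δ' s * δ e + δ s * δ' e := by simpa [signature] using hp he
      refine ⟨?_, ?_⟩
      · by_contra hcon
        simp only [signature, Set.mem_union, Set.mem_ofPred_eq, not_or, not_lt] at hcon
        nlinarith [hcon.1, hcon.2]
      · rintro rfl
        linarith [mul_comm (δ e) (δ' e)]
    · have h : -δ' s * δ e + δ s * δ' e < 0 := by simpa [signature] using hn he
      refine ⟨?_, ?_⟩
      · by_contra hcon
        simp only [signature, Set.mem_union, Set.mem_ofPred_eq, not_or, not_lt] at hcon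
        nlinarith [hcon.1, hcon.2]
      · rintro rfl
        linarith [mul_comm (δ e) (δ' e)]

end VectorConfiguration

/-! ## Oriented building sets and acyclic nested complexes -/

/-- An oriented building set: a building set and an oriented matroid on the same ground set such
that the supports of all circuits are blocks. -/
structure OrBuildingSet (E : Type*) where
  building : BuildingSet E
  matroid : OrMatroid E
  support_mem : ∀ c ∈ matroid.circuits, c.support ∈ building.blocks

/-- A family `N` of sets is acyclic for an oriented matroid if there are no circuit `c` and
subfamily `N' ⊆ N` with `c₊ ⊈ ⋃ N'` while `c₋ ⊆ ⋃ N'`. -/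
def OrMatroid.IsAcyclicFamily {E : Type*} (𝓜 : OrMatroid E) (N : Set (Set E)) : Prop :=
  ¬ ∃ c ∈ 𝓜.circuits, ∃ N' ⊆ N, ¬ c.pos ⊆ ⋃₀ N' ∧ c.neg ⊆ ⋃₀ N'

/-- The acyclic nested complex of an oriented building set: its faces are the sets `N \ κ(𝓑)` for
all acyclic nested sets `N`, where `κ(𝓑)` is the set of connected components. -/
def OrBuildingSet.acyclicNestedComplex {E : Type*} (P : OrBuildingSet E) :
    SimpComplex (Set E) where
  faces := {F | ∃ N : Set (Set E), P.building.IsNested N ∧ P.matroid.IsAcyclicFamily N ∧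
    (F : Set (Set E)) = N \ P.building.components}
  down_closed := by
    rintro s t ⟨N, hN, hA, hs⟩ hts
    have hts' : (t : Set (Set E)) ⊆ N \ P.building.components := hs ▸ Finset.coe_subset.2 hts
    have hsub : (t : Set (Set E)) ∪ P.building.components ⊆ N :=
      Set.union_subset (hts'.trans Set.sdiff_subset) hN.components_subset
    refine ⟨t ∪ P.building.components, ⟨hsub.trans hN.subset_blocks, Set.subset_union_right,
      fun B hB B' hB' => hN.nested_or_disjoint B (hsub hB) B' (hsub hB'),
      fun M hM => hN.union_notMem M (hM.trans hsub)⟩, ?_, ?_⟩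
    · rintro ⟨c, hc, N', hN', h⟩
      exact hA ⟨c, hc, N', hN'.trans hsub, h⟩
    · rw [Set.union_sdiff_right]
      exact (Set.disjoint_left.2 fun B hB => (hts' hB).2).sdiff_eq_left.symm

/-! ## Affine posets -/

/-- An affine poset of order `n ≥ 1`: a partial order `le` on `ℤ` that is compatible with the
translation by `n`. -/
structure AffinePoset (n : ℕ) where
  one_le : 1 ≤ n
  le : ℤ → ℤ → Prop
  refl : ∀ i, le i i
  trans : ∀ i j k, le i j → le j k → le i k
  antisymm : ∀ i j, le i j → le j i → i = j
  lt_shift : ∀ i, le i (i + n) ∧ i ≠ i + n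
  shift_iff : ∀ i j, le i j ↔ le (i + n) (j + n)
  directed : ∀ i j, ∃ k : ℕ, le i (j + k * n)

/-- The residue class modulo `n` of an integer. -/
def elementClass (n : ℕ) (i : ℤ) : Set ℤ := {x | ∃ k : ℤ, x = i + k * n}

/-- The translate `J + k n` of a set of integers. -/
def shiftSet (n : ℕ) (k : ℤ) (J : Set ℤ) : Set ℤ := (fun j => j + k * n) '' J

/-- The class of all translates `J + k n`, for `k ∈ ℤ`, of a set `J` of integers. -/
def subsetClass (n : ℕ) (J : Set ℤ) : Set (Set ℤ) := {S | ∃ k : ℤ, S = shiftSet n k J}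

namespace AffinePoset

variable {n : ℕ} (P : AffinePoset n)

/-- The strict order. -/
def lt (i j : ℤ) : Prop := P.le i j ∧ i ≠ j

/-- The cover relation. -/
def Covers (i j : ℤ) : Prop := P.lt i j ∧ ∀ k, P.lt i k → ¬ P.lt k j

/-- The (undirected) Hasse diagram. -/
def hasse : SimpleGraph ℤ where
  Adj i j := P.Covers i j ∨ P.Covers j i
  symm := ⟨fun _ _ h => h.symm⟩
  loopless := ⟨fun _ h => h.elim (fun h => h.1.2 rfl) (fun h => h.1.2 rfl)⟩

/-! ### The affine piping complex -/

/-- Order convex sets. -/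
def IsConvex (J : Set ℤ) : Prop := ∀ i j k, P.le i j → P.le j k → i ∈ J → k ∈ J → j ∈ J

/-- Sets inducing a connected subgraph of the Hasse diagram. -/
def IsConnected (J : Set ℤ) : Prop := (P.hasse.induce J).Connected

/-- Thin sets: all of `ℤ`, or at most one element in each residue class. -/
def IsThin (n : ℕ) (J : Set ℤ) : Prop :=
  J = Set.univ ∨ ∀ i ∈ J, ∀ j ∈ J, elementClass n i = elementClass n j → i = j

/-- Pipes. -/
def IsPipe (Q : Set ℤ) : Prop :=
  IsThin n Q ∧ P.IsConvex Q ∧ P.IsConnected Q ∧ Q.Nontrivial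

/-- Pipe classes. -/
def IsPipeClass (C : Set (Set ℤ)) : Prop := ∃ Q, P.IsPipe Q ∧ C = subsetClass n Q

/-- Nested subset classes. -/
def ClassNested (C C' : Set (Set ℤ)) : Prop := ∃ Q ∈ C, ∃ Q' ∈ C', Q ⊆ Q' ∨ Q' ⊆ Q

/-- Disjoint subset classes. -/
def ClassDisjoint (C C' : Set (Set ℤ)) : Prop := ∀ Q ∈ C, ∀ Q' ∈ C', Q ∩ Q' = ∅

/-- The arcs of the directed graph on the subsets of `ℤ`. -/
def Arc (Q R : Set ℤ) : Prop := Q ∩ R = ∅ ∧ ∃ q ∈ Q, ∃ r ∈ R, P.lt q r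

/-- The directed graph on the subsets of `ℤ` has no directed cycle among the members of `𝓢`. -/
def InducesAcyclic (𝓢 : Set (Set ℤ)) : Prop :=
  ∀ Q, ¬ Relation.TransGen (fun R R' => R ∈ 𝓢 ∧ R' ∈ 𝓢 ∧ P.Arc R R') Q Q

/-- Pipings. The vertices of the directed graph to look at are all the members of all the pipe
classes of the piping. -/
structure IsPiping (T : Set (Set (Set ℤ))) : Prop where
  isPipeClass : ∀ C ∈ T, P.IsPipeClass C
  univ_mem : subsetClass n Set.univ ∈ T
  nested_or_disjoint : ∀ C ∈ T, ∀ C' ∈ T, ClassNested C C' ∨ ClassDisjoint C C'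
  acyclic : P.InducesAcyclic (⋃₀ T)

/-- The affine piping complex: its faces are the pipings with the pipe class of `ℤ` removed. -/
def pipingComplex : SimpComplex (Set (Set ℤ)) where
  faces := {F | ∃ T, P.IsPiping T ∧ (F : Set (Set (Set ℤ))) = T \ {subsetClass n Set.univ}}
  down_closed := by
    rintro s t ⟨T, hT, hs⟩ hts
    have hts' : (t : Set (Set (Set ℤ))) ⊆ T \ {subsetClass n Set.univ} :=
      hs ▸ Finset.coe_subset.2 hts
    have hsub : (t : Set (Set (Set ℤ))) ∪ {subsetClass n Set.univ} ⊆ T :=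
      Set.union_subset (hts'.trans Set.sdiff_subset) (Set.singleton_subset_iff.2 hT.univ_mem)
    refine ⟨t ∪ {subsetClass n Set.univ}, ⟨fun C hC => hT.isPipeClass C (hsub hC), Or.inr rfl,
      fun C hC C' hC' => hT.nested_or_disjoint C (hsub hC) C' (hsub hC'), ?_⟩, ?_⟩
    · intro Q hQ
      refine hT.acyclic Q (Relation.TransGen.mono (fun R R' h => ?_) _ _ hQ)
      exact ⟨Set.sUnion_subset_sUnion hsub h.1, Set.sUnion_subset_sUnion hsub h.2.1, h.2.2⟩
    · rw [Set.union_sdiff_right]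
      exact (Set.disjoint_left.2 fun B hB => (hts' hB).2).sdiff_eq_left.symm

/-! ### The affine poset oriented building set -/

/-- The cover relations `i ⋖ j`, as pairs `(i, j)`. -/
def CoverPair : Type := {p : ℤ × ℤ // P.Covers p.1 p.2}

/-- Two cover relations are equivalent if they are translates by a multiple of `n`. -/
def coverSetoid : Setoid P.CoverPair where
  r p q := ∃ k : ℤ, q.1.1 = p.1.1 + k * n ∧ q.1.2 = p.1.2 + k * n
  iseqv :=
    { refl := fun _ => ⟨0, by simp, by simp⟩
      symm := by
        rintro p q ⟨k, h1, h2⟩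
        exact ⟨-k, by rw [h1]; ring, by rw [h2]; ring⟩
      trans := by
        rintro p q r ⟨k, h1, h2⟩ ⟨l, h3, h4⟩
        exact ⟨k + l, by rw [h3, h1]; ring, by rw [h4, h2]; ring⟩ }

/-- The cover relation classes. -/
def CoverClass : Type := Quotient P.coverSetoid

/-- The residue classes modulo `n` of the two endpoints of a cover relation class. -/
def endpoints : P.CoverClass → Set (Set ℤ) :=
  Quotient.lift (fun p => {elementClass n p.1.1, elementClass n p.1.2}) (by
    have h : ∀ i k : ℤ, elementClass n (i + k * n) = elementClass n i := by
      intro i k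
      ext x
      constructor
      · rintro ⟨l, rfl⟩
        exact ⟨k + l, by ring⟩
      · rintro ⟨l, rfl⟩
        exact ⟨l - k, by ring⟩
    rintro p q ⟨k, h1, h2⟩
    simp only [h1, h2, h])

/-- The line graph. -/
def lineGraph : SimpleGraph P.CoverClass where
  Adj e f := e ≠ f ∧ (P.endpoints e ∩ P.endpoints f).Nonempty
  symm := ⟨fun _ _ h => ⟨h.1.symm, by rw [Set.inter_comm]; exact h.2⟩⟩
  loopless := ⟨fun _ h => h.1 rfl⟩

/-- The vector `b_{j mod n} + (j div n) b_n` in `ℝ^{n+1}`, where `b_0, …, b_n` is the standard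
basis. -/
noncomputable def liftedBasis (n : ℕ) (j : ℤ) : Fin (n + 1) → ℝ :=
  Pi.single (Fin.ofNat (n + 1) (j % (n : ℤ)).toNat) 1 +
    ((j / (n : ℤ) : ℤ) : ℝ) • Pi.single (Fin.last n) 1

theorem liftedBasis_shift (hn : 1 ≤ n) (j k : ℤ) :
    liftedBasis n (j + k * n) = liftedBasis n j + (k : ℝ) • Pi.single (Fin.last n) 1 := by
  have h0 : (n : ℤ) ≠ 0 := by omega
  simp only [liftedBasis, Int.add_mul_emod_self_right, Int.add_mul_ediv_right _ _ h0, Int.cast_add,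
    add_smul, add_assoc]

/-- The incidence configuration: the vector of the class of `i ⋖ j` is `b̃_i - b̃_j`. -/
noncomputable def incidenceConfiguration : P.CoverClass → (Fin (n + 1) → ℝ) :=
  Quotient.lift (fun p => liftedBasis n p.1.1 - liftedBasis n p.1.2) (by
    rintro p q ⟨k, h1, h2⟩
    simp only [h1, h2, liftedBasis_shift P.one_le]
    abel)

/-- The oriented matroid of an affine poset. -/
noncomputable def orMatroid : OrMatroid P.CoverClass := configMatroid P.incidenceConfiguration

/-- The supports of the circuits of the oriented matroid of an affine poset. -/
def circuitSupports : Set (Set P.CoverClass) := {S | ∃ c ∈ P.orMatroid.circuits, S = c.support}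

/-- The affine poset oriented building set. -/
noncomputable def orBuildingSet : OrBuildingSet P.CoverClass where
  building := buildingClosure (graphTubes P.lineGraph ∪ P.circuitSupports)
  matroid := P.orMatroid
  support_mem c hc :=
    ⟨P.orMatroid.support_nonempty c hc, fun _ hX => hX (Or.inr ⟨c, hc, rfl⟩)⟩

end AffinePoset

/-! The bijection sends a pipe class to the set of cover relation classes lying inside its pipes
(`classEdgeSet`). The tool behind both directions is the contraction of a set `S` of cover relation
classes: make the endpoints of the covers in `S` equivalent and look at the induced preorder `PreLe
S` on the integers.

A family is acyclic exactly when the union `S` of each subfamily is a face of the vector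
configuration (`isAcyclicFamily_configMatroid_iff`). For `S ≠ univ`, being a face means that
contracting `S` gives an affine poset again (`IsContractible`). If `S` is a face, then a closed walk
in the contraction or a path in `S` from `x` to `x + k n` would give a forbidden dependence. If `S`
is contractible, a height function of the contraction is a linear functional that vanishes on `S`
and is negative off `S`.

Every block is a tube of the line graph or spans the vector `b_n`
(`mem_graphTubes_or_isUnbalanced`), and a proper face cannot span `b_n`. Hence the proper blocks of
an acyclic nested set are contractible tubes, and these are the edge sets of pipes
(`IsContractible.exists_isPipe`). A pipe is recovered, up to translation, as a connected component
of its edge set.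

It remains to match the two acyclicity conditions. A directed cycle of pipes would be collapsed by
the contraction of its edge sets, although one of its pipes is a full component
(`inducesAcyclic_of_isAcyclicFamily`). Conversely, if the pipes of a piping form no directed cycle,
then contracting any pairwise disjoint proper edge sets keeps the order antisymmetric
(`IsPiping.isContractible`). This yields the faces, and also shows that the union of at least two
disjoint edge sets is no block. -/

/-! ## Faces of a vector configuration -/

section VectorConfiguration

variable {E V : Type*} [AddCommGroup V] [Module ℝ V]

/-- A set `S` is a face of a vector configuration if every linear dependence that is nonnegative
outside of `S` vanishes outside of `S`. -/
def IsConfigFace (A : E → V) (S : Set E) : Prop :=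
  ∀ w : E →₀ ℝ, Finsupp.linearCombination ℝ A w = 0 → (∀ e ∉ S, 0 ≤ w e) → ∀ e ∉ S, w e = 0

/-- A dependence that is nonnegative and nonzero outside of `S` yields a circuit with these
properties. -/
theorem exists_circuit_of_dependence (A : E → V) (S : Set E) :
    ∀ (m : ℕ) (w : E →₀ ℝ), w.support.card ≤ m → Finsupp.linearCombination ℝ A w = 0 →
      (∀ e ∉ S, 0 ≤ w e) → (∃ e ∉ S, w e ≠ 0) →
      ∃ c ∈ configCircuits A, ¬ c.pos ⊆ S ∧ c.neg ⊆ S := by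
  intro m
  induction m with
  | zero =>
    rintro w hm - - ⟨e, -, he⟩
    rw [Finsupp.support_eq_empty.1 (Finset.card_eq_zero.1 (Nat.le_zero.1 hm))] at he
    exact absurd rfl he
  | succ m ih =>
    rintro w hm hw hpos ⟨e, heS, he⟩
    obtain ⟨c, hc, hp, hn⟩ := exists_conformal_circuit A _ w le_rfl hw (by
      rintro rfl; exact he rfl)
    have hneg : c.neg ⊆ S := fun s hs => by
      by_contra hsS
      exact absurd (hn hs) (not_lt.2 (hpos s hsS))
    by_cases hcS : c.pos ⊆ S
    · obtain ⟨⟨γ, hγ, rfl⟩, ⟨f, hf⟩, -⟩ := hc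
      have hγS : ∀ s ∉ S, γ s = 0 := fun s hs => by
        by_contra h
        rcases (mem_support_signature γ s).2 h with h | h
        · exact hs (hcS h)
        · exact hs (hneg h)
      have hγf := (mem_support_signature γ f).1 hf
      have hsub : ∀ s, γ s ≠ 0 → w s ≠ 0 := fun s h => by
        rcases (mem_support_signature γ s).2 h with h | h
        · exact (show 0 < w s from hp h).ne'
        · exact (show w s < 0 from hn h).ne
      -- A circuit inside `S` is useless, but subtracting this multiple of it removes `f` from the
      -- support and leaves the values outside `S` untouched, so the induction applies.
      have hoff : ∀ s ∉ S, (w - (w f / γ f) • γ) s = w s := fun s hs => by simp [hγS s hs]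
      have hsupp : (w - (w f / γ f) • γ).support ⊂ w.support := by
        rw [Finset.ssubset_iff_of_subset]
        · exact ⟨f, Finsupp.mem_support_iff.2 (hsub f hγf), by simp [hγf]⟩
        · intro s hs
          rw [Finsupp.mem_support_iff] at hs ⊢
          intro h0
          have : γ s = 0 := by
            by_contra h
            exact hsub s h h0
          simp [h0, this] at hs
      refine ih (w - (w f / γ f) • γ) (by have := Finset.card_lt_card hsupp; omega)
        (by simp [hw, hγ]) (fun s hs => ?_) ⟨e, heS, ?_⟩
      · rw [hoff s hs]; exact hpos s hs
      · rw [hoff e heS]; exact he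
    · exact ⟨c, hc, hcS, hneg⟩

/-- This trades circuits for arbitrary dependences, which can be built from walks and tested with
linear functionals. -/
theorem isAcyclicFamily_configMatroid_iff (A : E → V) (N : Set (Set E)) :
    (configMatroid A).IsAcyclicFamily N ↔ ∀ N' ⊆ N, IsConfigFace A (⋃₀ N') := by
  constructor
  · intro h N' hN' w hw hpos e he
    by_contra hne
    obtain ⟨c, hc, h1, h2⟩ := exists_circuit_of_dependence A _ _ w le_rfl hw hpos ⟨e, he, hne⟩
    exact h ⟨c, hc, N', hN', h1, h2⟩
  · rintro h ⟨c, ⟨⟨δ, hδ, rfl⟩, -, -⟩, N', hN', h1, h2⟩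
    obtain ⟨e, he, heS⟩ := Set.not_subset.1 h1
    refine (show 0 < δ e from he).ne' (h N' hN' δ hδ (fun s hs => ?_) e heS)
    by_contra hlt
    exact hs (h2 (not_le.1 hlt))

end VectorConfiguration

namespace AffinePoset

variable {n : ℕ} (P : AffinePoset n)

/-! ## Translations and heights -/

include P in
theorem n_pos : (0 : ℤ) < n := by
  have := P.one_le
  omega

theorem le_shift_iff (k i j : ℤ) : P.le (i + k * n) (j + k * n) ↔ P.le i j := by
  induction k using Int.induction_on with
  | zero => simp
  | succ k ih =>
    rw [← ih, P.shift_iff (i + k * n)]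
    ring_nf
  | pred k ih =>
    rw [← ih, P.shift_iff (i + (-k - 1) * n)]
    ring_nf

theorem lt_shift_iff (k i j : ℤ) : P.lt (i + k * n) (j + k * n) ↔ P.lt i j := by
  simp [lt, le_shift_iff]

theorem covers_shift (k : ℤ) {i j : ℤ} (h : P.Covers i j) : P.Covers (i + k * n) (j + k * n) := by
  refine ⟨(P.lt_shift_iff k i j).2 h.1, fun l h1 h2 => ?_⟩
  refine h.2 (l - k * n) ((P.lt_shift_iff k _ _).1 ?_) ((P.lt_shift_iff k _ _).1 ?_)
  · simpa using h1
  · simpa using h2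

theorem le_add_mul (i : ℤ) {k : ℤ} (hk : 0 ≤ k) : P.le i (i + k * n) := by
  lift k to ℕ using hk
  induction k with
  | zero => simpa using P.refl i
  | succ k ih =>
    refine P.trans _ _ _ ih ?_
    have := (P.lt_shift (i + k * n)).1
    push_cast
    convert this using 1
    ring

/-- Every translation invariant preorder that extends the affine poset and in which no element is
above its translate has a height function. -/
theorem exists_height (R : ℤ → ℤ → Prop) (hle : ∀ x y, P.le x y → R x y)
    (htrans : ∀ x y z, R x y → R y z → R x z)
    (hshift : ∀ (k : ℤ) x y, R x y → R (x + k * n) (y + k * n))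
    (hirr : ∀ x, ¬ R (x + n) x) :
    ∃ f : ℤ → ℤ, (∀ x, f (x + n) = f x + n) ∧ (∀ x y, R x y → f x ≤ f y) ∧
      ∀ x y, R x y → ¬ R y x → f x < f y := by
  have hn := P.n_pos
  have hbd : ∀ r x : ℤ, ∃ m : ℤ, IsGreatest {k : ℤ | R (r + k * n) x} m := by
    intro r x
    have hex : ∃ b : ℤ, ∀ z : ℤ, R (r + z * n) x → z ≤ b := by
      obtain ⟨k, hk⟩ := P.directed x r
      refine ⟨k, fun z hz => ?_⟩
      by_contra hlt
      -- If `z > k`, then `r + k n + n` is below `r + z n`, hence below `x`, hence below `r + k n`.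
      refine hirr (r + k * n) (htrans _ _ _ (hle _ _ ?_) (htrans _ _ _ hz (hle _ _ hk)))
      have := P.le_add_mul (r + k * n + n) (k := z - k - 1) (by omega)
      convert this using 1
      ring
    have hne : ∃ z : ℤ, R (r + z * n) x := by
      obtain ⟨k, hk⟩ := P.directed r x
      refine ⟨-k, hle _ _ ((P.le_shift_iff k _ _).1 ?_)⟩
      convert hk using 1
      ring
    obtain ⟨m, h1, h2⟩ := Int.exists_greatest_of_bdd hex hne
    exact ⟨m, h1, fun z hz => h2 z hz⟩
  choose m hm using hbd
  have hmono : ∀ r x y, R x y → m r x ≤ m r y := fun r x y h =>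
    (hm r y).2 (htrans _ _ _ (hm r x).1 h)
  have hstep : ∀ r x, m r (x + n) = m r x + 1 := fun r x => by
    refine le_antisymm ?_ ((hm r (x + n)).2 ?_)
    · have := hshift (-1) _ _ (hm r (x + n)).1
      have h2 : m r (x + n) - 1 ≤ m r x := (hm r x).2 (by
        show R _ _
        convert this using 1 <;> ring)
      omega
    · have := hshift 1 _ _ (hm r x).1
      show R _ _
      convert this using 1 <;> ring
  -- Here `m r x` is the largest `k` with `r + k n` below `x`. Each of the `n` summands grows by one
  -- under `x ↦ x + n`. The summand of the residue of `y` makes the height strict: it is at least `y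
  -- / n` at `y`, and the same bound at `x` would put `y` below `x`.
  refine ⟨fun x => ∑ r ∈ Finset.range n, m r x, fun x => ?_,
    fun x y h => Finset.sum_le_sum fun r _ => hmono r x y h, fun x y h h' => ?_⟩
  · simp [hstep, Finset.sum_add_distrib]
  · refine Finset.sum_lt_sum (fun r _ => hmono r x y h) ⟨(y % n).toNat, ?_, ?_⟩
    · have := Int.emod_lt_of_pos y hn
      have := Int.emod_nonneg y hn.ne'
      rw [Finset.mem_range]
      omega
    · have hr : (((y % n).toNat : ℕ) : ℤ) = y - (y / n) * n := by
        rw [Int.toNat_of_nonneg (Int.emod_nonneg y hn.ne')]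
        have := Int.emod_add_mul_ediv y n
        linarith
      set r : ℤ := (((y % n).toNat : ℕ) : ℤ)
      have h1 : y / n ≤ m r y := (hm r y).2 (by
        show R _ _
        rw [hr]
        convert hle _ _ (P.refl y) using 1
        ring)
      refine lt_of_lt_of_le ?_ h1
      by_contra hlt
      refine h' (htrans _ _ _ (hle _ _ ?_) (hm r x).1)
      have := P.le_add_mul y (k := m r x - y / n) (by omega)
      convert this using 1
      linear_combination hr

/-- A strictly increasing integer height bounds the length of chains from `x` to `y`, so refining a
chain must stop at covers. -/
theorem reflTransGen_covers {x y : ℤ} (h : P.le x y) : Relation.ReflTransGen P.Covers x y := by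
  obtain ⟨f, -, -, hf⟩ := P.exists_height P.le (fun _ _ h => h) P.trans
    (fun k x y => (P.le_shift_iff k x y).2)
    (fun x h => (P.lt_shift x).2 (P.antisymm _ _ (P.lt_shift x).1 h))
  have hlt : ∀ {x y}, P.lt x y → f x < f y := fun h =>
    hf _ _ h.1 fun h' => h.2 (P.antisymm _ _ h.1 h')
  have key : ∀ (m : ℕ) (x y : ℤ), P.le x y → (f y - f x).toNat ≤ m →
      Relation.ReflTransGen P.Covers x y := by
    intro m
    induction m with
    | zero =>
      intro x y h hm
      by_cases hxy : x = y
      · rw [hxy]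
      · have := hlt ⟨h, hxy⟩
        omega
    | succ m ih =>
      intro x y h hm
      by_cases hxy : x = y
      · rw [hxy]
      by_cases hc : P.Covers x y
      · exact .single hc
      have : ∃ z, P.lt x z ∧ P.lt z y := by
        by_contra hcon
        push Not at hcon
        exact hc ⟨⟨h, hxy⟩, hcon⟩
      obtain ⟨z, h1, h2⟩ := this
      have := hlt h1
      have := hlt h2
      exact (ih x z h1.1 (by omega)).trans (ih z y h2.1 (by omega))
  exact key _ x y h le_rfl

/-! ## Cover relation classes -/

/-- The class of a cover relation. -/
def coverClass {i j : ℤ} (h : P.Covers i j) : P.CoverClass :=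
  Quotient.mk P.coverSetoid ⟨(i, j), h⟩

theorem exists_coverClass_eq (e : P.CoverClass) :
    ∃ (i j : ℤ) (h : P.Covers i j), P.coverClass h = e := by
  obtain ⟨⟨⟨i, j⟩, h⟩, rfl⟩ := Quotient.exists_rep e
  exact ⟨i, j, h, rfl⟩

theorem coverClass_eq_iff {i j i' j' : ℤ} (h : P.Covers i j) (h' : P.Covers i' j') :
    P.coverClass h = P.coverClass h' ↔ ∃ k : ℤ, i' = i + k * n ∧ j' = j + k * n :=
  ⟨fun H => Quotient.exact H, fun H => Quotient.sound H⟩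

theorem coverClass_shift (k : ℤ) {i j : ℤ} (h : P.Covers i j) :
    P.coverClass (P.covers_shift k h) = P.coverClass h :=
  ((P.coverClass_eq_iff _ _).2 ⟨k, rfl, rfl⟩).symm

theorem incidenceConfiguration_coverClass {i j : ℤ} (h : P.Covers i j) :
    P.incidenceConfiguration (P.coverClass h) = liftedBasis n i - liftedBasis n j := rfl

theorem endpoints_coverClass {i j : ℤ} (h : P.Covers i j) :
    P.endpoints (P.coverClass h) = {elementClass n i, elementClass n j} := rfl

theorem elementClass_eq_iff {i j : ℤ} :
    elementClass n i = elementClass n j ↔ ∃ k : ℤ, j = i + k * n := by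
  constructor
  · intro h
    have : j ∈ elementClass n j := ⟨0, by ring⟩
    rwa [← h] at this
  · rintro ⟨k, rfl⟩
    ext x
    constructor
    · rintro ⟨l, rfl⟩
      exact ⟨l - k, by ring⟩
    · rintro ⟨l, rfl⟩
      exact ⟨k + l, by ring⟩

theorem exists_covers_of_le {x y : ℤ} (h : P.lt x y) :
    ∃ z, P.Covers x z ∧ P.le z y := by
  have hle : ∀ {a b}, Relation.ReflTransGen P.Covers a b → P.le a b := fun h => by
    induction h with
    | refl => exact P.refl _
    | tail _ h ih => exact P.trans _ _ _ ih h.1.1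
  rcases (P.reflTransGen_covers h.1).cases_head with h' | ⟨z, h1, h2⟩
  · exact absurd h' h.2
  · exact ⟨z, h1, hle h2⟩

instance : Nonempty P.CoverClass := by
  obtain ⟨z, hz, -⟩ := P.exists_covers_of_le (P.lt_shift 0)
  exact ⟨P.coverClass hz⟩

/-- Of two distinct translates of `j`, the smaller would lie strictly between `i` and the larger.
Thus a class is determined by the residues of its endpoints, whence finiteness. -/
theorem eq_zero_of_covers {i j k : ℤ} (h : P.Covers i j) (h' : P.Covers i (j + k * n)) :
    k = 0 := by
  have hn := P.n_pos
  by_contra hk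
  have hne : j ≠ j + k * n := fun h => by
    have : k * n = 0 := by linarith
    rcases mul_eq_zero.1 this with h | h <;> omega
  rcases le_total 0 k with hk' | hk'
  · exact h'.2 j h.1 ⟨P.le_add_mul j hk', hne⟩
  · refine h.2 _ h'.1 ⟨?_, hne.symm⟩
    have := P.le_add_mul (j + k * n) (k := -k) (by omega)
    convert this using 1
    ring

instance : Finite P.CoverClass := by
  have hn := P.n_pos
  have hex : ∀ e : P.CoverClass, ∃ p : Fin n × Fin n, ∃ (i j : ℤ) (h : P.Covers i j),
      P.coverClass h = e ∧ i % n = (p.1 : ℕ) ∧ j % n = (p.2 : ℕ) := by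
    intro e
    obtain ⟨i, j, h, rfl⟩ := P.exists_coverClass_eq e
    have h1 := Int.emod_nonneg i hn.ne'
    have h2 := Int.emod_lt_of_pos i hn
    have h3 := Int.emod_nonneg j hn.ne'
    have h4 := Int.emod_lt_of_pos j hn
    exact ⟨(⟨(i % n).toNat, by omega⟩, ⟨(j % n).toNat, by omega⟩), i, j, h, rfl,
      by simp [h1], by simp [h3]⟩
  choose p hp using hex
  refine Finite.of_injective p fun e e' hee => ?_
  obtain ⟨i, j, h, rfl, h1, h2⟩ := hp e
  obtain ⟨i', j', h', rfl, h3, h4⟩ := hp e'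
  rw [hee, ← h3] at h1
  rw [hee, ← h4] at h2
  obtain ⟨k, hk⟩ := Int.ModEq.dvd (n := n) h1
  obtain ⟨l, hl⟩ := Int.ModEq.dvd (n := n) h2
  rw [P.coverClass_eq_iff]
  refine ⟨k, by linarith, ?_⟩
  have h5 := P.covers_shift (-k) h'
  rw [show i' + -k * n = i by linarith, show j' + -k * n = j + (l - k) * n by linarith] at h5
  have := P.eq_zero_of_covers h h5
  rw [show k = l by omega]
  linarith

end AffinePoset

namespace AffinePoset

variable {n : ℕ} (P : AffinePoset n)

/-! ## Contracting a set of cover relation classes -/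

/-- The integers `x` and `y` are the endpoints of a cover relation whose class is in `S`. -/
def Link (S : Set P.CoverClass) (x y : ℤ) : Prop :=
  (∃ h : P.Covers x y, P.coverClass h ∈ S) ∨ ∃ h : P.Covers y x, P.coverClass h ∈ S

/-- The integers `x` and `y` are connected by cover relations with classes in `S`. -/
def Conn (S : Set P.CoverClass) : ℤ → ℤ → Prop := Relation.ReflTransGen (P.Link S)

/-- The preorder obtained from the affine poset by making connected integers equivalent. -/
def PreLe (S : Set P.CoverClass) : ℤ → ℤ → Prop :=
  Relation.ReflTransGen fun x y => P.Covers x y ∨ P.Link S x y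

variable {P} {S S' : Set P.CoverClass}

theorem Link.symm {x y : ℤ} (h : P.Link S x y) : P.Link S y x := Or.symm h

theorem Link.shift (k : ℤ) {x y : ℤ} (h : P.Link S x y) :
    P.Link S (x + k * n) (y + k * n) := by
  rcases h with ⟨h, hS⟩ | ⟨h, hS⟩
  · exact .inl ⟨P.covers_shift k h, by rwa [coverClass_shift]⟩
  · exact .inr ⟨P.covers_shift k h, by rwa [coverClass_shift]⟩

theorem Link.mono (hS : S ⊆ S') {x y : ℤ} (h : P.Link S x y) : P.Link S' x y :=
  h.imp (fun ⟨h, h'⟩ => ⟨h, hS h'⟩) fun ⟨h, h'⟩ => ⟨h, hS h'⟩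

instance : Std.Symm (P.Link S) := ⟨fun _ _ h => Link.symm h⟩

theorem Conn.symm {x y : ℤ} (h : P.Conn S x y) : P.Conn S y x :=
  Relation.ReflTransGen.stdSymm.symm _ _ h

theorem Conn.trans {x y z : ℤ} (h : P.Conn S x y) (h' : P.Conn S y z) : P.Conn S x z :=
  Relation.ReflTransGen.trans h h'

theorem Conn.shift (k : ℤ) {x y : ℤ} (h : P.Conn S x y) :
    P.Conn S (x + k * n) (y + k * n) :=
  Relation.ReflTransGen.lift (fun z => z + k * n) (fun _ _ h => Link.shift k h) _ _ h

theorem Conn.mono (hS : S ⊆ S') {x y : ℤ} (h : P.Conn S x y) : P.Conn S' x y :=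
  Relation.ReflTransGen.mono (fun _ _ h => h.mono hS) _ _ h

theorem Conn.preLe {x y : ℤ} (h : P.Conn S x y) : P.PreLe S x y :=
  Relation.ReflTransGen.mono (fun _ _ h => Or.inr h) _ _ h

theorem PreLe.trans {x y z : ℤ} (h : P.PreLe S x y) (h' : P.PreLe S y z) : P.PreLe S x z :=
  Relation.ReflTransGen.trans h h'

theorem PreLe.shift (k : ℤ) {x y : ℤ} (h : P.PreLe S x y) :
    P.PreLe S (x + k * n) (y + k * n) :=
  Relation.ReflTransGen.lift (fun z => z + k * n)
    (fun _ _ h => h.imp (P.covers_shift k) (Link.shift k)) _ _ h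

theorem preLe_of_le {x y : ℤ} (h : P.le x y) : P.PreLe S x y :=
  Relation.ReflTransGen.mono (fun _ _ h => Or.inl h) _ _ (P.reflTransGen_covers h)

theorem conn_univ_of_le {x y : ℤ} (h : P.le x y) : P.Conn Set.univ x y :=
  Relation.ReflTransGen.mono (fun _ _ h => Or.inl ⟨h, trivial⟩) _ _ (P.reflTransGen_covers h)

theorem conn_univ (x y : ℤ) : P.Conn Set.univ x y := by
  obtain ⟨k, hk⟩ := P.directed x y
  exact (conn_univ_of_le hk).trans (conn_univ_of_le (P.le_add_mul y (by omega))).symm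

variable (P)

/-- The set `S` contains enough cover relation classes to express the last basis vector. -/
def IsUnbalanced (S : Set P.CoverClass) : Prop :=
  ∃ w : P.CoverClass →₀ ℝ, (∀ e ∉ S, w e = 0) ∧
    Finsupp.linearCombination ℝ P.incidenceConfiguration w = Pi.single (Fin.last n) 1

/-- Contracting the components of `S` yields an affine poset whose cover relations come from
classes outside of `S`. -/
structure IsContractible (S : Set P.CoverClass) : Prop where
  conn_of_preLe : ∀ x y, P.PreLe S x y → P.PreLe S y x → P.Conn S x y
  eq_zero_of_conn : ∀ x k : ℤ, P.Conn S x (x + k * n) → k = 0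
  coverClass_mem : ∀ (i j : ℤ) (h : P.Covers i j), P.Conn S i j → P.coverClass h ∈ S

variable {P}

/-! ### Linear dependences from walks -/

open Classical in
theorem exists_weight_of_link {x y : ℤ} (h : P.Link S x y) : ∃ w : P.CoverClass →₀ ℝ,
    Finsupp.linearCombination ℝ P.incidenceConfiguration w = liftedBasis n x - liftedBasis n y ∧
      ∀ e ∉ S, w e = 0 := by
  rcases h with ⟨h, hS⟩ | ⟨h, hS⟩
  · refine ⟨Finsupp.single (P.coverClass h) 1, by simp [incidenceConfiguration_coverClass],
      fun e he => Finsupp.single_eq_of_ne ?_⟩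
    rintro rfl
    exact he hS
  · refine ⟨Finsupp.single (P.coverClass h) (-1), by simp [incidenceConfiguration_coverClass],
      fun e he => Finsupp.single_eq_of_ne ?_⟩
    rintro rfl
    exact he hS

theorem Conn.exists_weight {x y : ℤ} (h : P.Conn S x y) : ∃ w : P.CoverClass →₀ ℝ,
    Finsupp.linearCombination ℝ P.incidenceConfiguration w = liftedBasis n x - liftedBasis n y ∧
      ∀ e ∉ S, w e = 0 := by
  induction h with
  | refl => exact ⟨0, by simp, by simp⟩
  | tail _ h ih =>
    obtain ⟨w, h1, h2⟩ := ih
    obtain ⟨w', h3, h4⟩ := exists_weight_of_link h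
    exact ⟨w + w', by simp [h1, h3], fun e he => by simp [h2 e he, h4 e he]⟩

theorem exists_weight_of_covers {x y : ℤ} (h : P.Covers x y) : ∃ w : P.CoverClass →₀ ℝ,
    Finsupp.linearCombination ℝ P.incidenceConfiguration w = liftedBasis n x - liftedBasis n y ∧
      (∀ e, 0 ≤ w e) ∧ 0 < w (P.coverClass h) := by
  classical
  refine ⟨Finsupp.single (P.coverClass h) 1, by simp [incidenceConfiguration_coverClass],
    fun e => ?_, by simp⟩
  rw [Finsupp.single_apply]
  split_ifs <;> norm_num

/-- The vectors telescope along the walk. Only upward covers use classes outside `S`, so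
coefficients there never cancel: one is positive as soon as the walk leaves `S`. -/
theorem PreLe.exists_weight {x y : ℤ} (h : P.PreLe S x y) : ∃ w : P.CoverClass →₀ ℝ,
    Finsupp.linearCombination ℝ P.incidenceConfiguration w = liftedBasis n x - liftedBasis n y ∧
      (∀ e ∉ S, 0 ≤ w e) ∧ (P.Conn S x y ∨ ∃ e ∉ S, 0 < w e) := by
  induction h with
  | refl => exact ⟨0, by simp, by simp, .inl .refl⟩
  | @tail y z _ h ih =>
    obtain ⟨w, h1, h2, h5⟩ := ih
    by_cases hl : P.Link S y z
    · obtain ⟨w', h3, h4⟩ := exists_weight_of_link hl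
      refine ⟨w + w', by simp [h1, h3], fun e he => by simp [h2 e he, h4 e he],
        h5.imp (fun h5 => h5.tail hl) ?_⟩
      rintro ⟨e, he, h6⟩
      exact ⟨e, he, by simp [h6, h4 e he]⟩
    · have hc := h.resolve_right hl
      obtain ⟨w', h3, h4, h6⟩ := exists_weight_of_covers hc
      have he : P.coverClass hc ∉ S := fun h => hl (.inl ⟨hc, h⟩)
      exact ⟨w + w', by simp [h1, h3], fun e he => add_nonneg (h2 e he) (h4 e),
        .inr ⟨_, he, add_pos_of_nonneg_of_pos (h2 _ he) h6⟩⟩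

/-- Take a cover `i ⋖ j` with class outside `S` and continue upwards from `j` to `i + k n`. The
vectors of this walk sum to `-k b_n`. If `S` spanned `b_n`, this could be cancelled inside `S`,
leaving a dependence that is nonnegative off `S` and positive at `i ⋖ j`. -/
theorem not_isUnbalanced_of_isConfigFace (hS : S ≠ Set.univ)
    (h : IsConfigFace P.incidenceConfiguration S) : ¬ P.IsUnbalanced S := by
  rintro ⟨γ, hγ, hγ'⟩
  obtain ⟨e, he⟩ := (Set.ne_univ_iff_exists_notMem S).1 hS
  obtain ⟨i, j, hij, rfl⟩ := P.exists_coverClass_eq e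
  obtain ⟨k, hk⟩ := P.directed j i
  obtain ⟨w, h1, h2, h3⟩ := exists_weight_of_covers hij
  obtain ⟨w', h4, h5, -⟩ := (preLe_of_le (S := S) hk).exists_weight
  have h6 := h (w + w' + (k : ℝ) • γ) (by
    have := liftedBasis_shift P.one_le i k
    simp only [Int.cast_natCast] at this
    simp only [map_add, map_smul, h1, h4, hγ', this]
    abel) (fun e he => by
      simpa [hγ e he] using add_nonneg (h2 e) (h5 e he)) _ he
  have := h5 _ he
  simp [hγ _ he] at h6
  linarith

/-- Each failure produces something forbidden: a closed walk with a step outside `S`, an expression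
of `b_n` by a path in `S`, or a cover outside `S` closed up by a path in `S`. -/
theorem isContractible_of_isConfigFace (hS : S ≠ Set.univ)
    (h : IsConfigFace P.incidenceConfiguration S) : P.IsContractible S where
  conn_of_preLe x y hxy hyx := by
    obtain ⟨w, h1, h2, h3⟩ := hxy.exists_weight
    obtain ⟨w', h4, h5, -⟩ := hyx.exists_weight
    refine h3.resolve_right ?_
    rintro ⟨e, he, h6⟩
    have := h (w + w') (by simp [h1, h4]) (fun e he => add_nonneg (h2 e he) (h5 e he)) e he
    simp at this
    linarith [h5 e he]
  eq_zero_of_conn x k hk := by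
    by_contra hk0
    obtain ⟨w, h1, h2⟩ := hk.exists_weight
    refine not_isUnbalanced_of_isConfigFace hS h
      ⟨(-(k : ℝ)⁻¹) • w, fun e he => by simp [h2 e he], ?_⟩
    have : (k : ℝ) ≠ 0 := by exact_mod_cast hk0
    rw [map_smul, h1, liftedBasis_shift P.one_le, sub_add_cancel_left, smul_neg, neg_smul,
      neg_neg, smul_smul, inv_mul_cancel₀ this, one_smul]
  coverClass_mem i j hij hc := by
    by_contra he
    obtain ⟨w, h1, h2, h3⟩ := exists_weight_of_covers hij
    obtain ⟨w', h4, h5⟩ := hc.symm.exists_weight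
    have := h (w + w') (by simp [h1, h4]) (fun e he => by simpa [h5 e he] using h2 e) _ he
    simp [h5 _ he] at this
    linarith

/-! ### Linear functionals from heights -/

theorem exists_functional (hn : 1 ≤ n) (g : ℤ → ℝ) (c : ℝ) (hg : ∀ x, g (x + n) = g x + c) :
    ∃ ψ : (Fin (n + 1) → ℝ) →ₗ[ℝ] ℝ, (∀ j, ψ (liftedBasis n j) = g j) ∧
      ψ (Pi.single (Fin.last n) 1) = c := by
  have hn' : (0 : ℤ) < n := by omega
  have hk : ∀ (k : ℤ) x, g (x + k * n) = g x + k * c := by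
    intro k x
    induction k using Int.induction_on with
    | zero => simp
    | succ k ih =>
      rw [show x + ((k : ℤ) + 1) * n = x + k * n + n by ring, hg, ih]
      push_cast
      ring
    | pred k ih =>
      have := hg (x + (-k - 1) * n)
      rw [show x + (-(k : ℤ) - 1) * n + n = x + -k * n by ring, ih] at this
      push_cast at this ⊢
      linarith
  -- The functional is prescribed on the standard basis; quasi-periodicity of `g` extends the
  -- agreement from `0, …, n - 1` to all integers.
  let v : Fin (n + 1) → ℝ := fun i => if i = Fin.last n then c else g (i : ℕ)
  have hv : ∀ (i : Fin (n + 1)) (a : ℝ),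
      (∑ i, v i • (LinearMap.proj i : (Fin (n + 1) → ℝ) →ₗ[ℝ] ℝ)) (Pi.single i a) = v i * a := by
    intro i a
    simp [LinearMap.sum_apply, Pi.single_apply]
  refine ⟨∑ i, v i • LinearMap.proj i, fun j => ?_, by rw [hv]; simp [v]⟩
  have h1 := Int.emod_nonneg j hn'.ne'
  have h2 := Int.emod_lt_of_pos j hn'
  have h3 : ((Fin.ofNat (n + 1) (j % (n : ℤ)).toNat : Fin (n + 1)) : ℕ) = (j % (n : ℤ)).toNat := by
    rw [Fin.val_ofNat, Nat.mod_eq_of_lt (by omega)]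
  have h4 : v (Fin.ofNat (n + 1) (j % (n : ℤ)).toNat) = g (j % n) := by
    have : Fin.ofNat (n + 1) (j % (n : ℤ)).toNat ≠ Fin.last n := fun h => by
      have := congrArg Fin.val h
      rw [h3, Fin.val_last] at this
      omega
    simp only [v, if_neg this, h3, Int.toNat_of_nonneg h1]
  have h5 : g j = g (j % n) + (j / n : ℤ) * c := by
    rw [← hk, mul_comm, Int.emod_add_mul_ediv]
  rw [liftedBasis, map_add, map_smul, hv, hv, h4, h5]
  simp [v]

theorem map_linearCombination_eq_sum {E V : Type*} [AddCommGroup V] [Module ℝ V] (A : E → V)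
    (ψ : V →ₗ[ℝ] ℝ) (w : E →₀ ℝ) :
    ψ (Finsupp.linearCombination ℝ A w) = ∑ e ∈ w.support, w e * ψ (A e) := by
  simp [Finsupp.linearCombination_apply, Finsupp.sum, map_sum]

namespace IsContractible

/-- The functional is a height of the contracted preorder. It is constant along links, and it
increases strictly on a cover outside `S`, since a way back would connect its ends and force its
class into `S`. -/
theorem exists_functional (h : P.IsContractible S) :
    ∃ ψ : (Fin (n + 1) → ℝ) →ₗ[ℝ] ℝ, ψ (Pi.single (Fin.last n) 1) ≠ 0 ∧
      (∀ e ∈ S, ψ (P.incidenceConfiguration e) = 0) ∧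
      ∀ e ∉ S, ψ (P.incidenceConfiguration e) < 0 := by
  have hn := P.n_pos
  obtain ⟨f, h1, h2, h3⟩ := P.exists_height (P.PreLe S) (fun _ _ h => preLe_of_le h)
    (fun _ _ _ => PreLe.trans) (fun k _ _ => PreLe.shift k) (fun x hx => by
      have := h.eq_zero_of_conn x 1 (by
        rw [one_mul]
        exact h.conn_of_preLe _ _ (preLe_of_le (P.lt_shift x).1) hx)
      omega)
  obtain ⟨ψ, h4, h5⟩ := AffinePoset.exists_functional P.one_le (fun x => (f x : ℝ)) n
    (fun x => by simp [h1])
  refine ⟨ψ, ?_, fun e he => ?_, fun e he => ?_⟩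
  · rw [h5]
    exact_mod_cast hn.ne'
  · obtain ⟨i, j, hij, rfl⟩ := P.exists_coverClass_eq e
    have hl : P.Conn S i j := .single (.inl ⟨hij, he⟩)
    rw [incidenceConfiguration_coverClass, map_sub, h4, h4,
      le_antisymm (h2 _ _ hl.preLe) (h2 _ _ hl.symm.preLe), sub_self]
  · obtain ⟨i, j, hij, rfl⟩ := P.exists_coverClass_eq e
    rw [incidenceConfiguration_coverClass, map_sub, h4, h4, sub_neg]
    have hp : P.PreLe S i j := preLe_of_le hij.1.1
    exact_mod_cast h3 i j hp fun h' => he (h.coverClass_mem i j hij (h.conn_of_preLe _ _ hp h'))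

theorem not_isUnbalanced (h : P.IsContractible S) : ¬ P.IsUnbalanced S := by
  rintro ⟨w, hw, hw'⟩
  obtain ⟨ψ, h1, h2, -⟩ := h.exists_functional
  apply h1
  rw [← hw', map_linearCombination_eq_sum]
  refine Finset.sum_eq_zero fun e _ => ?_
  by_cases he : e ∈ S
  · rw [h2 e he, mul_zero]
  · rw [hw e he, zero_mul]

/-- Applying the functional to a dependence that is nonnegative off `S` gives a vanishing sum of
nonpositive terms, so every term is zero. -/
theorem isConfigFace (h : P.IsContractible S) : IsConfigFace P.incidenceConfiguration S := by
  intro w hw hpos e he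
  obtain ⟨ψ, -, h2, h3⟩ := h.exists_functional
  have hsum := map_linearCombination_eq_sum P.incidenceConfiguration ψ w
  rw [hw, map_zero, eq_comm, Finset.sum_eq_zero_iff_of_nonpos] at hsum
  · by_contra hne
    rcases mul_eq_zero.1 (hsum e (Finsupp.mem_support_iff.2 hne)) with h | h
    · exact hne h
    · exact (h3 e he).ne h
  · intro e _
    by_cases he : e ∈ S
    · rw [h2 e he, mul_zero]
    · exact mul_nonpos_of_nonneg_of_nonpos (hpos e he) (h3 e he).le

end IsContractible

theorem isConfigFace_univ : IsConfigFace P.incidenceConfiguration Set.univ :=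
  fun _ _ _ _ he => absurd trivial he

end AffinePoset

namespace AffinePoset

variable {n : ℕ} {P : AffinePoset n} {S S' : Set P.CoverClass}

/-! ## Tubes of the line graph -/

theorem elementClass_mem_endpoints_iff {e : P.CoverClass} {x : ℤ} :
    elementClass n x ∈ P.endpoints e ↔ ∃ y, P.Link {e} x y := by
  obtain ⟨i, j, h, rfl⟩ := P.exists_coverClass_eq e
  rw [endpoints_coverClass]
  constructor
  · rintro (hx | hx)
    · obtain ⟨k, rfl⟩ := elementClass_eq_iff.1 hx.symm
      exact ⟨j + k * n, .inl ⟨P.covers_shift k h, P.coverClass_shift k h⟩⟩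
    · obtain ⟨k, rfl⟩ := elementClass_eq_iff.1 (Set.mem_singleton_iff.1 hx).symm
      exact ⟨i + k * n, .inr ⟨P.covers_shift k h, P.coverClass_shift k h⟩⟩
  · rintro ⟨y, ⟨h', he⟩ | ⟨h', he⟩⟩
    · obtain ⟨k, rfl, rfl⟩ := (P.coverClass_eq_iff _ _).1 (Set.mem_singleton_iff.1 he).symm
      exact .inl (elementClass_eq_iff.2 ⟨k, rfl⟩).symm
    · obtain ⟨k, rfl, rfl⟩ := (P.coverClass_eq_iff _ _).1 (Set.mem_singleton_iff.1 he).symm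
      exact .inr (elementClass_eq_iff.2 ⟨k, rfl⟩).symm

theorem exists_eq_elementClass {e : P.CoverClass} {c : Set ℤ} (h : c ∈ P.endpoints e) :
    ∃ x, c = elementClass n x := by
  obtain ⟨i, j, hij, rfl⟩ := P.exists_coverClass_eq e
  rcases h with rfl | rfl <;> exact ⟨_, rfl⟩

theorem Link.exists_coverClass {x y : ℤ} (h : P.Link S x y) : ∃ e ∈ S, P.Link {e} x y := by
  rcases h with ⟨h, hS⟩ | ⟨h, hS⟩
  · exact ⟨_, hS, .inl ⟨h, rfl⟩⟩
  · exact ⟨_, hS, .inr ⟨h, rfl⟩⟩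

theorem reachable_of_link {x y z : ℤ} {e e' : P.CoverClass} (he : e ∈ S) (he' : e' ∈ S)
    (h : P.Link {e} x y) (h' : P.Link {e'} x z) :
    (P.lineGraph.induce S).Reachable ⟨e, he⟩ ⟨e', he'⟩ := by
  by_cases hee : e = e'
  · subst hee
    exact .refl _
  · refine SimpleGraph.Adj.reachable ⟨hee, elementClass n x, ?_, ?_⟩
    · exact elementClass_mem_endpoints_iff.2 ⟨y, h⟩
    · exact elementClass_mem_endpoints_iff.2 ⟨z, h'⟩

theorem Conn.reachable {x y : ℤ} (h : P.Conn S x y) {x' : ℤ} {e : P.CoverClass} (he : e ∈ S)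
    (hx : P.Link {e} x x') {y' : ℤ} {e' : P.CoverClass} (he' : e' ∈ S) (hy : P.Link {e'} y y') :
    (P.lineGraph.induce S).Reachable ⟨e, he⟩ ⟨e', he'⟩ := by
  induction h generalizing y' e' with
  | refl => exact reachable_of_link he he' hx hy
  | tail _ h ih =>
    obtain ⟨f, hf, hl⟩ := h.exists_coverClass
    exact (ih hf hl).trans (reachable_of_link hf he' hl.symm hy)

theorem mem_graphTubes_of_conn (hS : S.Nonempty)
    (h : ∀ (i j i' j' : ℤ) (hc : P.Covers i j) (hc' : P.Covers i' j'), P.coverClass hc ∈ S →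
      P.coverClass hc' ∈ S → ∃ k : ℤ, P.Conn S i (i' + k * n)) :
    S ∈ graphTubes P.lineGraph := by
  refine ⟨hS, @SimpleGraph.Connected.mk _ _ ?_ hS.to_subtype⟩
  rintro ⟨e, he⟩ ⟨e', he'⟩
  obtain ⟨i, j, hc, rfl⟩ := P.exists_coverClass_eq e
  obtain ⟨i', j', hc', rfl⟩ := P.exists_coverClass_eq e'
  obtain ⟨k, hk⟩ := h i j i' j' hc hc' he he'
  exact hk.reachable he (.inl ⟨hc, rfl⟩) he'
    (y' := j' + k * n) (.inl ⟨P.covers_shift k hc', P.coverClass_shift k hc'⟩)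

theorem exists_conn_of_link {e : P.CoverClass} (he : e ∈ S) {x x' y y' : ℤ}
    (hx : P.Link {e} x x') (hy : P.Link {e} y y') : ∃ k : ℤ, P.Conn S x (y + k * n) := by
  have hS : ({e} : Set P.CoverClass) ⊆ S := Set.singleton_subset_iff.2 he
  have key : ∀ {i j i' j' : ℤ} (h : P.Covers i j) (h' : P.Covers i' j'),
      P.coverClass h = e → P.coverClass h' = e → ∃ k : ℤ, i = i' + k * n ∧ j = j' + k * n :=
    fun h h' he he' => (P.coverClass_eq_iff h' h).1 (he'.trans he.symm)
  have hxx : P.Conn S x x' := .single (hx.mono hS)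
  rcases hx with ⟨hx, hxe⟩ | ⟨hx, hxe⟩ <;> rcases hy with ⟨hy, hye⟩ | ⟨hy, hye⟩ <;>
    obtain ⟨k, h1, h2⟩ := key hx hy hxe hye <;> refine ⟨k, ?_⟩
  · rw [← h1]
    exact .refl
  · rwa [← h2]
  · rwa [← h1]
  · rw [← h2]
    exact .refl

/-- The line graph sees endpoints only modulo `n`, so a path in it lifts to the integers up to a
translation that accumulates along the path. -/
theorem exists_conn_of_mem_graphTubes (hS : S ∈ graphTubes P.lineGraph) {e e' : P.CoverClass}
    (he : e ∈ S) (he' : e' ∈ S) {x x' y y' : ℤ} (hx : P.Link {e} x x') (hy : P.Link {e'} y y') :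
    ∃ k : ℤ, P.Conn S x (y + k * n) := by
  have h := (SimpleGraph.reachable_iff_reflTransGen _ _).1
    (hS.2.preconnected ⟨e, he⟩ ⟨e', he'⟩)
  have key : ∀ f : S, Relation.ReflTransGen (P.lineGraph.induce S).Adj ⟨e, he⟩ f →
      ∀ y y', P.Link {f.1} y y' → ∃ k : ℤ, P.Conn S x (y + k * n) := by
    intro f hf
    induction hf with
    | refl => exact fun y y' hy => exists_conn_of_link he hx hy
    | @tail f g _ h ih =>
      intro y y' hy
      obtain ⟨-, c, hc, hc'⟩ := h
      obtain ⟨z, rfl⟩ := exists_eq_elementClass hc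
      obtain ⟨u, hu⟩ := elementClass_mem_endpoints_iff.1 hc
      obtain ⟨v, hv⟩ := elementClass_mem_endpoints_iff.1 hc'
      obtain ⟨k, hk⟩ := ih z u hu
      obtain ⟨l, hl⟩ := exists_conn_of_link g.2 hv hy
      refine ⟨l + k, hk.trans ?_⟩
      have := hl.shift k
      rwa [add_assoc, ← add_mul] at this
  exact key _ h y y' hy

theorem union_mem_graphTubes (hS : S ∈ graphTubes P.lineGraph) (hS' : S' ∈ graphTubes P.lineGraph)
    {e e' : P.CoverClass} (he : e ∈ S) (he' : e' ∈ S') {x y z : ℤ} (h : P.Link {e} x y)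
    (h' : P.Link {e'} x z) : S ∪ S' ∈ graphTubes P.lineGraph := by
  refine ⟨hS.1.inl, ?_⟩
  by_cases hee : e = e'
  · subst hee
    exact SimpleGraph.induce_union_connected hS.2.preconnected hS'.2.preconnected ⟨e, he, he'⟩
  · refine SimpleGraph.connected_induce_union hS.2.preconnected hS'.2.preconnected he he'
      ⟨hee, elementClass n x, ?_, ?_⟩
    · exact elementClass_mem_endpoints_iff.2 ⟨y, h⟩
    · exact elementClass_mem_endpoints_iff.2 ⟨z, h'⟩

theorem univ_mem_graphTubes : (Set.univ : Set P.CoverClass) ∈ graphTubes P.lineGraph :=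
  mem_graphTubes_of_conn Set.univ_nonempty fun _ _ _ _ _ _ _ _ => ⟨0, conn_univ _ _⟩

/-! ## Blocks -/

theorem IsUnbalanced.mono (hS : S ⊆ S') (h : P.IsUnbalanced S) : P.IsUnbalanced S' := by
  obtain ⟨w, h1, h2⟩ := h
  exact ⟨w, fun e he => h1 e fun h => he (hS h), h2⟩

theorem liftedBasis_castSucc (j : ℤ) (r : Fin n) :
    liftedBasis n j r.castSucc = if (j % (n : ℤ)).toNat = r then 1 else 0 := by
  have hn : (0 : ℤ) < n := by
    have := r.2
    omega
  have h1 := Int.emod_nonneg j hn.ne'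
  have h2 := Int.emod_lt_of_pos j hn
  have h3 : r.castSucc = Fin.ofNat (n + 1) (j % (n : ℤ)).toNat ↔ (j % (n : ℤ)).toNat = r := by
    rw [Fin.ext_iff, Fin.val_ofNat, Nat.mod_eq_of_lt (by omega), Fin.val_castSucc, eq_comm]
  simp only [liftedBasis, Pi.add_apply, Pi.smul_apply, Pi.single_apply, h3,
    (Fin.castSucc_lt_last r).ne, if_false, smul_zero, add_zero]

theorem elementClass_eq_of_emod {j : ℤ} {r : Fin n} (h : (j % (n : ℤ)).toNat = r) :
    elementClass n (r : ℕ) = elementClass n j := by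
  have hn : (0 : ℤ) < n := by
    have := r.2
    omega
  have h1 := Int.emod_nonneg j hn.ne'
  refine elementClass_eq_iff.2 ⟨j / n, ?_⟩
  rw [← h, Int.toNat_of_nonneg h1, mul_comm, Int.emod_add_mul_ediv]

theorem elementClass_mem_endpoints_of_ne_zero {e : P.CoverClass} {r : Fin n}
    (h : P.incidenceConfiguration e r.castSucc ≠ 0) : elementClass n (r : ℕ) ∈ P.endpoints e := by
  obtain ⟨i, j, hij, rfl⟩ := P.exists_coverClass_eq e
  rw [incidenceConfiguration_coverClass, Pi.sub_apply, liftedBasis_castSucc,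
    liftedBasis_castSucc] at h
  rw [endpoints_coverClass]
  by_cases h1 : (i % (n : ℤ)).toNat = r
  · exact .inl (elementClass_eq_of_emod h1)
  by_cases h2 : (j % (n : ℤ)).toNat = r
  · exact .inr (elementClass_eq_of_emod h2)
  simp [h1, h2] at h

theorem linearCombination_apply_eq_zero {E ι : Type*} (A : E → ι → ℝ) (r : ι) (w : E →₀ ℝ)
    (h : ∀ e, w e ≠ 0 → A e r = 0) : Finsupp.linearCombination ℝ A w r = 0 := by
  have := map_linearCombination_eq_sum A (LinearMap.proj r) w
  rw [LinearMap.proj_apply] at this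
  rw [this]
  refine Finset.sum_eq_zero fun e he => ?_
  rw [LinearMap.proj_apply, h e (Finsupp.mem_support_iff.1 he), mul_zero]

/-- Restrict the dependence to one line graph component of its support. Different components meet
different residues, so the first `n` coordinates of the restricted sum still vanish. If the last one
does not, the support spans `b_n`; if it does, minimality makes this component the whole support. -/
theorem mem_graphTubes_or_isUnbalanced_of_circuit {c : SignedSubset P.CoverClass}
    (hc : c ∈ P.orMatroid.circuits) :
    c.support ∈ graphTubes P.lineGraph ∨ P.IsUnbalanced c.support := by
  classical
  obtain ⟨⟨δ, hδ, rfl⟩, ⟨e, he⟩, hmin⟩ := hc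
  set S := (signature δ).support with hS
  have hmem : ∀ f, f ∈ S ↔ δ f ≠ 0 := mem_support_signature δ
  rw [or_iff_not_imp_right]
  intro hbal
  let S₁ : Set P.CoverClass :=
    {f | ∃ hf : f ∈ S, (P.lineGraph.induce S).Reachable ⟨e, he⟩ ⟨f, hf⟩}
  let δ₁ : P.CoverClass →₀ ℝ := δ.filter (· ∈ S₁)
  have hin : ∀ f ∈ S₁, δ₁ f = δ f := fun f hf => Finsupp.filter_apply_pos _ _ hf
  have hout : ∀ f ∉ S₁, δ₁ f = 0 := fun f hf => Finsupp.filter_apply_neg _ _ hf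
  have heS₁ : e ∈ S₁ := ⟨he, .refl _⟩
  have hzero : ∀ r : Fin n,
      Finsupp.linearCombination ℝ P.incidenceConfiguration δ₁ r.castSucc = 0 := by
    intro r
    by_cases hr : ∃ f ∈ S₁, elementClass n (r : ℕ) ∈ P.endpoints f
    · obtain ⟨f, ⟨hf, hef⟩, hrf⟩ := hr
      -- The component meets the residue `r`, so the rest of the support does not.
      have h0 : Finsupp.linearCombination ℝ P.incidenceConfiguration (δ - δ₁) r.castSucc = 0 := by
        refine linearCombination_apply_eq_zero _ _ _ fun g hg => ?_
        by_contra hgr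
        have hg₁ : g ∉ S₁ := fun h => hg (by simp [hin g h])
        have hgS : g ∈ S := by
          rw [hmem]
          simpa [hout g hg₁] using hg
        obtain ⟨y, hy⟩ := elementClass_mem_endpoints_iff.1 hrf
        obtain ⟨z, hz⟩ := elementClass_mem_endpoints_iff.1
          (elementClass_mem_endpoints_of_ne_zero hgr)
        exact hg₁ ⟨hgS, hef.trans (reachable_of_link hf hgS hy hz)⟩
      rw [map_sub, hδ, zero_sub, Pi.neg_apply, neg_eq_zero] at h0
      exact h0
    · refine linearCombination_apply_eq_zero _ _ _ fun g hg => ?_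
      by_contra hgr
      refine hr ⟨g, ?_, elementClass_mem_endpoints_of_ne_zero hgr⟩
      by_contra h
      exact hg (hout g h)
  have hL : Finsupp.linearCombination ℝ P.incidenceConfiguration δ₁ = 0 := by
    funext i
    refine Fin.lastCases ?_ hzero i
    by_contra hne
    set v := Finsupp.linearCombination ℝ P.incidenceConfiguration δ₁ (Fin.last n) with hv
    refine hbal ⟨v⁻¹ • δ₁, fun f hf => ?_, ?_⟩
    · rw [Finsupp.smul_apply, hout f (fun h => hf h.1), smul_zero]
    · rw [map_smul]
      funext j
      refine Fin.lastCases ?_ (fun r => ?_) j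
      · simpa [← hv] using inv_mul_cancel₀ hne
      · simp [hzero r, (Fin.castSucc_lt_last r).ne]
  have hS₁ : (signature δ₁).support = S := by
    refine hmin _ ⟨δ₁, hL, rfl⟩ ⟨e, ?_⟩ fun f hf => ?_
    · rw [mem_support_signature, hin e heS₁, ← hmem]
      exact he
    · rw [mem_support_signature] at hf
      by_contra h
      exact hf (hout f fun h' => h h'.1)
  refine ⟨⟨e, he⟩, (SimpleGraph.connected_iff_exists_forall_reachable _).2
    ⟨⟨e, he⟩, fun ⟨f, hf⟩ => ?_⟩⟩
  by_contra h
  have h1 : f ∉ S₁ := fun h' => h h'.2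
  rw [← hS₁, mem_support_signature] at hf
  exact hf (hout f h1)

variable (P) in
/-- The building set whose blocks are the tubes and the unbalanced sets. -/
def tubeOrUnbalanced : BuildingSet P.CoverClass where
  blocks := {S | S.Nonempty ∧ (S ∈ graphTubes P.lineGraph ∨ P.IsUnbalanced S)}
  nonempty_of_mem _ h := h.1
  singleton_mem e := ⟨Set.singleton_nonempty e, .inl ⟨Set.singleton_nonempty e,
    (SimpleGraph.connected_iff_exists_forall_reachable _).2 ⟨⟨e, rfl⟩, fun ⟨f, hf⟩ => by
      obtain rfl : f = e := hf
      exact .refl _⟩⟩⟩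
  union_mem S hS S' hS' h := by
    refine ⟨hS.1.inl, ?_⟩
    rcases hS.2 with h1 | h1
    · rcases hS'.2 with h2 | h2
      · exact .inl ⟨hS.1.inl,
          SimpleGraph.induce_union_connected h1.2.preconnected h2.2.preconnected h⟩
      · exact .inr (h2.mono Set.subset_union_right)
    · exact .inr (h1.mono Set.subset_union_left)

theorem mem_blocks_of_mem_graphTubes (h : S ∈ graphTubes P.lineGraph) :
    S ∈ P.orBuildingSet.building.blocks := ⟨h.1, fun _ hX => hX (.inl h)⟩

/-- Tubes and unbalanced sets together already form a building set, because being unbalanced passes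
to supersets; minimality of the closure does the rest. -/
theorem mem_graphTubes_or_isUnbalanced (h : S ∈ P.orBuildingSet.building.blocks) :
    S ∈ graphTubes P.lineGraph ∨ P.IsUnbalanced S := by
  refine (h.2 P.tubeOrUnbalanced ?_).2
  rintro T (hT | ⟨c, hc, rfl⟩)
  · exact ⟨hT.1, .inl hT⟩
  · exact ⟨P.orMatroid.support_nonempty c hc, mem_graphTubes_or_isUnbalanced_of_circuit hc⟩

theorem components_orBuildingSet : P.orBuildingSet.building.components = {Set.univ} := by
  have h := mem_blocks_of_mem_graphTubes (univ_mem_graphTubes (P := P))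
  ext B
  constructor
  · rintro ⟨-, hB⟩
    exact (hB _ h (Set.subset_univ B)).symm
  · rintro rfl
    exact ⟨h, fun B' _ hB' => Set.univ_subset_iff.1 hB'⟩

end AffinePoset

namespace AffinePoset

variable {n : ℕ} {P : AffinePoset n} {S : Set P.CoverClass} {Q Q' : Set ℤ}

/-! ## Pipes and their cover relation classes -/

variable (P) in
/-- The classes of the cover relations between elements of `Q`. -/
def edgeSet (Q : Set ℤ) : Set P.CoverClass :=
  {e | ∃ (i j : ℤ) (h : P.Covers i j), i ∈ Q ∧ j ∈ Q ∧ P.coverClass h = e}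

variable (P) in
/-- The classes of the cover relations between elements of a member of the class `C`. -/
def classEdgeSet (C : Set (Set ℤ)) : Set P.CoverClass := {e | ∃ Q ∈ C, e ∈ P.edgeSet Q}

theorem mem_shiftSet {k x : ℤ} : x ∈ shiftSet n k Q ↔ x - k * n ∈ Q := by
  constructor
  · rintro ⟨y, hy, rfl⟩
    simpa using hy
  · intro h
    exact ⟨_, h, by simp⟩

theorem shiftSet_zero : shiftSet n 0 Q = Q := by
  ext x
  simp [mem_shiftSet]

theorem shiftSet_shiftSet (k l : ℤ) : shiftSet n k (shiftSet n l Q) = shiftSet n (l + k) Q := by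
  ext x
  rw [mem_shiftSet, mem_shiftSet, mem_shiftSet]
  ring_nf

theorem mem_subsetClass_self : Q ∈ subsetClass n Q := ⟨0, shiftSet_zero.symm⟩

theorem subsetClass_shiftSet (k : ℤ) : subsetClass n (shiftSet n k Q) = subsetClass n Q := by
  ext R
  constructor
  · rintro ⟨l, rfl⟩
    exact ⟨k + l, shiftSet_shiftSet _ _⟩
  · rintro ⟨l, rfl⟩
    exact ⟨l - k, by rw [shiftSet_shiftSet, add_sub_cancel]⟩

theorem subsetClass_eq_of_mem (h : Q' ∈ subsetClass n Q) : subsetClass n Q' = subsetClass n Q := by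
  obtain ⟨k, rfl⟩ := h
  exact subsetClass_shiftSet k

theorem edgeSet_mono (h : Q ⊆ Q') : P.edgeSet Q ⊆ P.edgeSet Q' := by
  rintro e ⟨i, j, hc, hi, hj, rfl⟩
  exact ⟨i, j, hc, h hi, h hj, rfl⟩

theorem edgeSet_subset_edgeSet_shiftSet (k : ℤ) : P.edgeSet Q ⊆ P.edgeSet (shiftSet n k Q) := by
  rintro e ⟨i, j, hc, hi, hj, rfl⟩
  exact ⟨_, _, P.covers_shift k hc, ⟨i, hi, rfl⟩, ⟨j, hj, rfl⟩, P.coverClass_shift k hc⟩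

theorem edgeSet_shiftSet (k : ℤ) : P.edgeSet (shiftSet n k Q) = P.edgeSet Q := by
  refine Set.Subset.antisymm ?_ (edgeSet_subset_edgeSet_shiftSet k)
  have h := edgeSet_subset_edgeSet_shiftSet (P := P) (Q := shiftSet n k Q) (-k)
  rwa [shiftSet_shiftSet, add_neg_cancel, shiftSet_zero] at h

theorem edgeSet_eq_of_mem (h : Q' ∈ subsetClass n Q) : P.edgeSet Q' = P.edgeSet Q := by
  obtain ⟨k, rfl⟩ := h
  exact edgeSet_shiftSet k

theorem classEdgeSet_subsetClass (Q : Set ℤ) : P.classEdgeSet (subsetClass n Q) = P.edgeSet Q := by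
  ext e
  constructor
  · rintro ⟨R, hR, he⟩
    rwa [edgeSet_eq_of_mem hR] at he
  · exact fun h => ⟨Q, mem_subsetClass_self, h⟩

theorem edgeSet_univ : P.edgeSet Set.univ = Set.univ := by
  refine Set.eq_univ_of_forall fun e => ?_
  obtain ⟨i, j, h, rfl⟩ := P.exists_coverClass_eq e
  exact ⟨i, j, h, trivial, trivial, rfl⟩

theorem conn_of_reachable {a b : Q} (h : (P.hasse.induce Q).Reachable a b) :
    P.Conn (P.edgeSet Q) a b := by
  rw [SimpleGraph.reachable_iff_reflTransGen] at h
  refine Relation.ReflTransGen.lift Subtype.val ?_ _ _ h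
  rintro ⟨x, hx⟩ ⟨y, hy⟩ (h | h)
  · exact .inl ⟨h, _, _, h, hx, hy, rfl⟩
  · exact .inr ⟨h, _, _, h, hy, hx, rfl⟩

theorem reachable_of_conn {x y : ℤ} (h : P.Conn S x y) (hQ : ∀ z, P.Conn S x z → z ∈ Q) :
    (P.hasse.induce Q).Reachable ⟨x, hQ x .refl⟩ ⟨y, hQ y h⟩ := by
  induction h with
  | refl => exact .refl _
  | tail h1 h2 ih =>
    refine ih.trans (SimpleGraph.Adj.reachable ?_)
    exact h2.imp (fun h => h.1) fun h => h.1

theorem IsThin.eq_zero (hQ : IsThin n Q) (hne : Q ≠ Set.univ) (hn : 1 ≤ n) {x k : ℤ} (hx : x ∈ Q)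
    (hx' : x + k * n ∈ Q) : k = 0 := by
  have := hQ.resolve_left hne x hx _ hx' (elementClass_eq_iff.2 ⟨k, rfl⟩)
  have : k * n = 0 := by linarith
  rcases mul_eq_zero.1 this with h | h <;> omega

theorem isPipe_univ : P.IsPipe Set.univ := by
  refine ⟨.inl rfl, fun _ _ _ _ _ _ _ => trivial, ?_, ⟨0, trivial, 1, trivial, by norm_num⟩⟩
  refine (SimpleGraph.connected_iff_exists_forall_reachable _).2 ⟨⟨0, trivial⟩, fun ⟨x, _⟩ => ?_⟩
  exact reachable_of_conn (conn_univ (P := P) 0 x) fun _ _ => trivial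

namespace IsPipe

theorem conn (hQ : P.IsPipe Q) {x y : ℤ} (hx : x ∈ Q) (hy : y ∈ Q) :
    P.Conn (P.edgeSet Q) x y :=
  conn_of_reachable (hQ.2.2.1.preconnected ⟨x, hx⟩ ⟨y, hy⟩)

/-- The link is a translate of a cover inside `Q`, and thinness forces the translation to be zero.
Hence `Q` is a full component of its edge set, which is why edge sets determine pipes up to
translation. -/
theorem mem_of_link (hQ : P.IsPipe Q) {x y : ℤ} (hx : x ∈ Q) (h : P.Link (P.edgeSet Q) x y) :
    y ∈ Q := by
  by_cases hne : Q = Set.univ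
  · rw [hne]
    trivial
  rcases h with ⟨hc, i, j, hc', hi, hj, he⟩ | ⟨hc, i, j, hc', hi, hj, he⟩ <;>
    obtain ⟨k, rfl, rfl⟩ := (P.coverClass_eq_iff _ _).1 he
  · rw [hQ.1.eq_zero hne P.one_le hi hx]
    simpa using hj
  · rw [hQ.1.eq_zero hne P.one_le hj hx]
    simpa using hi

theorem mem_of_conn (hQ : P.IsPipe Q) {x y : ℤ} (hx : x ∈ Q) (h : P.Conn (P.edgeSet Q) x y) :
    y ∈ Q := by
  induction h with
  | refl => exact hx
  | tail _ h ih => exact hQ.mem_of_link ih h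

theorem shift (hQ : P.IsPipe Q) (k : ℤ) : P.IsPipe (shiftSet n k Q) := by
  have hback : ∀ {x y : ℤ}, x - k * n ∈ Q → P.Conn (P.edgeSet Q) x y → y - k * n ∈ Q := by
    intro x y hx h
    have := h.shift (-k)
    rw [neg_mul, ← sub_eq_add_neg, ← sub_eq_add_neg] at this
    exact hQ.mem_of_conn hx this
  refine ⟨?_, fun i j l hij hjl hi hl => ?_, ?_, hQ.2.2.2.image (add_left_injective _)⟩
  · rcases hQ.1 with h | h
    · left
      ext x
      simp [mem_shiftSet, h]
    · right
      rintro _ ⟨x, hx, rfl⟩ _ ⟨y, hy, rfl⟩ hxy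
      have := h x hx y hy
      rw [this]
      obtain ⟨l, hl⟩ := elementClass_eq_iff.1 hxy
      exact elementClass_eq_iff.2 ⟨l, by linarith⟩
  · rw [mem_shiftSet] at hi hl ⊢
    refine hQ.2.1 _ _ _ ((P.le_shift_iff k _ _).1 ?_) ((P.le_shift_iff k _ _).1 ?_) hi hl
    · simpa using hij
    · simpa using hjl
  · obtain ⟨x, hx⟩ := hQ.2.2.2.nonempty
    have hsub : ∀ z, P.Conn (P.edgeSet Q) (x + k * n) z → z ∈ shiftSet n k Q := fun z hz =>
      mem_shiftSet.2 (hback (x := x + k * n) (by simpa using hx) hz)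
    refine (SimpleGraph.connected_iff_exists_forall_reachable _).2
      ⟨⟨x + k * n, hsub _ .refl⟩, fun ⟨y, hy⟩ => ?_⟩
    have hxy := (hQ.conn hx (mem_shiftSet.1 hy)).shift k
    rw [sub_add_cancel] at hxy
    exact reachable_of_conn hxy hsub

theorem of_mem (hQ : P.IsPipe Q) (h : Q' ∈ subsetClass n Q) : P.IsPipe Q' := by
  obtain ⟨k, rfl⟩ := h
  exact hQ.shift k

theorem exists_link (hQ : P.IsPipe Q) {x : ℤ} (hx : x ∈ Q) : ∃ y, P.Link (P.edgeSet Q) x y := by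
  obtain ⟨y, hy, hyx⟩ := hQ.2.2.2.exists_ne x
  rcases (hQ.conn hx hy).cases_head with h | ⟨z, h, -⟩
  · exact absurd h.symm hyx
  · exact ⟨z, h⟩

theorem edgeSet_nonempty (hQ : P.IsPipe Q) : (P.edgeSet Q).Nonempty := by
  obtain ⟨x, hx⟩ := hQ.2.2.2.nonempty
  obtain ⟨y, hy⟩ := hQ.exists_link hx
  obtain ⟨e, he, -⟩ := hy.exists_coverClass
  exact ⟨e, he⟩

theorem edgeSet_mem_graphTubes (hQ : P.IsPipe Q) : P.edgeSet Q ∈ graphTubes P.lineGraph := by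
  refine mem_graphTubes_of_conn hQ.edgeSet_nonempty ?_
  rintro i j i' j' hc hc' ⟨a, b, hab, ha, -, he⟩ ⟨a', b', hab', ha', -, he'⟩
  obtain ⟨k, rfl, -⟩ := (P.coverClass_eq_iff _ _).1 he
  obtain ⟨l, rfl, -⟩ := (P.coverClass_eq_iff _ _).1 he'
  refine ⟨k - l, ?_⟩
  have := (hQ.conn ha ha').shift k
  convert this using 1
  ring

/-- Translates of pipes that touch are comparable when their cover relation classes are. -/
theorem subset_of_mem (hQ : P.IsPipe Q) (hQ' : P.IsPipe Q') (h : P.edgeSet Q ⊆ P.edgeSet Q') {x : ℤ}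
    (hx : x ∈ Q) (hx' : x ∈ Q') : Q ⊆ Q' := fun _ hy =>
  hQ'.mem_of_conn hx' ((hQ.conn hx hy).mono h)

theorem exists_shiftSet_subset (hQ : P.IsPipe Q) (hQ' : P.IsPipe Q')
    (h : P.edgeSet Q ⊆ P.edgeSet Q') : ∃ k : ℤ, shiftSet n k Q ⊆ Q' := by
  obtain ⟨e, he⟩ := hQ.edgeSet_nonempty
  obtain ⟨i', j', hc', hi', -, he'⟩ := h he
  obtain ⟨i, j, hc, hi, -, rfl⟩ := he
  obtain ⟨k, rfl, -⟩ := (P.coverClass_eq_iff _ _).1 he'.symm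
  exact ⟨k, (hQ.shift k).subset_of_mem hQ' (by rwa [edgeSet_shiftSet]) ⟨i, hi, rfl⟩ hi'⟩

theorem eq_of_mem (hQ : P.IsPipe Q) (hQ' : P.IsPipe Q') (h : P.edgeSet Q = P.edgeSet Q') {x : ℤ}
    (hx : x ∈ Q) (hx' : x ∈ Q') : Q = Q' :=
  (hQ.subset_of_mem hQ' h.subset hx hx').antisymm (hQ'.subset_of_mem hQ h.superset hx' hx)

theorem subsetClass_eq (hQ : P.IsPipe Q) (hQ' : P.IsPipe Q') (h : P.edgeSet Q = P.edgeSet Q') :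
    subsetClass n Q = subsetClass n Q' := by
  obtain ⟨k, hk⟩ := hQ.exists_shiftSet_subset hQ' h.subset
  obtain ⟨x, hx⟩ := (hQ.shift k).2.2.2.nonempty
  rw [← (hQ.shift k).eq_of_mem hQ' (by rwa [edgeSet_shiftSet]) hx (hk hx), subsetClass_shiftSet]

end IsPipe

theorem classEdgeSet_injOn : Set.InjOn P.classEdgeSet {C | P.IsPipeClass C} := by
  rintro _ ⟨Q, hQ, rfl⟩ _ ⟨Q', hQ', rfl⟩ h
  rw [classEdgeSet_subsetClass, classEdgeSet_subsetClass] at h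
  exact hQ.subsetClass_eq hQ' h

theorem classEdgeSet_univ : P.classEdgeSet (subsetClass n Set.univ) = Set.univ := by
  rw [classEdgeSet_subsetClass, edgeSet_univ]

/-- A contractible tube is the set of cover relation classes of a pipe. -/
theorem IsContractible.exists_isPipe (h : P.IsContractible S) (hS : S ∈ graphTubes P.lineGraph) :
    ∃ Q, P.IsPipe Q ∧ P.edgeSet Q = S := by
  obtain ⟨e, he⟩ := hS.1
  obtain ⟨i, j, hij, rfl⟩ := P.exists_coverClass_eq e
  have hl : P.Conn S i j := .single (.inl ⟨hij, he⟩)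
  -- The pipe is the component of one endpoint. Thinness, convexity and the absence of extra covers
  -- each come from one condition of contractibility; the tube property ensures that translates of
  -- this component reach all of `S`.
  refine ⟨{x | P.Conn S i x}, ⟨.inr ?_, ?_, ?_, ⟨i, .refl, j, hl, hij.1.2⟩⟩, ?_⟩
  · intro x hx y hy hxy
    obtain ⟨k, rfl⟩ := elementClass_eq_iff.1 hxy
    rw [h.eq_zero_of_conn x k (hx.symm.trans hy)]
    simp
  · intro x y z hxy hyz hx hz
    refine hx.trans (h.conn_of_preLe _ _ (preLe_of_le hxy) ((preLe_of_le hyz).trans ?_))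
    exact (hz.symm.trans hx).preLe
  · exact (SimpleGraph.connected_iff_exists_forall_reachable _).2 ⟨⟨i, .refl⟩, fun ⟨x, hx⟩ =>
      reachable_of_conn hx fun _ h => h⟩
  · ext e'
    constructor
    · rintro ⟨x, y, hxy, hx, hy, rfl⟩
      exact h.coverClass_mem x y hxy (hx.symm.trans hy)
    · intro he'
      obtain ⟨x, y, hxy, rfl⟩ := P.exists_coverClass_eq e'
      obtain ⟨k, hk⟩ := exists_conn_of_mem_graphTubes hS he he' (.inl ⟨hij, rfl⟩)
        (.inl ⟨hxy, rfl⟩)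
      exact ⟨_, _, P.covers_shift k hxy, hk,
        hk.tail (.inl ⟨P.covers_shift k hxy, by rwa [coverClass_shift]⟩), P.coverClass_shift k hxy⟩

end AffinePoset

namespace AffinePoset

variable {n : ℕ} {P : AffinePoset n} {S : Set P.CoverClass} {Q Q' : Set ℤ}

/-! ## From acyclic nested sets to pipings -/

theorem subsetClass_eq_of_isPipeClass {C : Set (Set ℤ)} (hC : P.IsPipeClass C) (hQ : Q ∈ C) :
    C = subsetClass n Q := by
  obtain ⟨R, -, rfl⟩ := hC
  exact (subsetClass_eq_of_mem hQ).symm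

theorem isPipe_of_isPipeClass {C : Set (Set ℤ)} (hC : P.IsPipeClass C) (hQ : Q ∈ C) :
    P.IsPipe Q := by
  obtain ⟨R, hR, rfl⟩ := hC
  exact hR.of_mem hQ

theorem exists_mem_shiftSet_of_link {x y : ℤ} (h : P.Link (P.edgeSet Q) x y) :
    ∃ k : ℤ, x ∈ shiftSet n k Q ∧ y ∈ shiftSet n k Q := by
  rcases h with ⟨hc, i, j, hc', hi, hj, he⟩ | ⟨hc, i, j, hc', hi, hj, he⟩ <;>
    obtain ⟨k, rfl, rfl⟩ := (P.coverClass_eq_iff _ _).1 he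
  · exact ⟨k, ⟨i, hi, rfl⟩, ⟨j, hj, rfl⟩⟩
  · exact ⟨k, ⟨j, hj, rfl⟩, ⟨i, hi, rfl⟩⟩

section OfNested

variable {N : Set (Set P.CoverClass)}

theorem exists_isPipe_of_mem (hN : P.orBuildingSet.building.IsNested N)
    (hA : P.orBuildingSet.matroid.IsAcyclicFamily N) {B : Set P.CoverClass} (hB : B ∈ N) :
    ∃ Q, P.IsPipe Q ∧ P.edgeSet Q = B := by
  by_cases hne : B = Set.univ
  · exact ⟨Set.univ, isPipe_univ, by rw [edgeSet_univ, hne]⟩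
  have hface := (isAcyclicFamily_configMatroid_iff _ _).1 hA {B} (Set.singleton_subset_iff.2 hB)
  rw [Set.sUnion_singleton] at hface
  refine (isContractible_of_isConfigFace hne hface).exists_isPipe ?_
  exact (mem_graphTubes_or_isUnbalanced (hN.subset_blocks hB)).resolve_right
    (not_isUnbalanced_of_isConfigFace hne hface)

/-- Touching pipes whose cover relation classes are in a nested set have comparable sets of cover
relation classes. -/
theorem edgeSet_subset_or_subset (hN : P.orBuildingSet.building.IsNested N) (hQ : P.IsPipe Q)
    (hQ' : P.IsPipe Q') (h : P.edgeSet Q ∈ N) (h' : P.edgeSet Q' ∈ N) {x : ℤ} (hx : x ∈ Q)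
    (hx' : x ∈ Q') : P.edgeSet Q ⊆ P.edgeSet Q' ∨ P.edgeSet Q' ⊆ P.edgeSet Q := by
  rcases hN.nested_or_disjoint _ h _ h' with h1 | h1 | h1
  · exact .inl h1
  · exact .inr h1
  exfalso
  obtain ⟨y, hy⟩ := hQ.exists_link hx
  obtain ⟨z, hz⟩ := hQ'.exists_link hx'
  obtain ⟨e, he, hey⟩ := hy.exists_coverClass
  obtain ⟨f, hf, hfz⟩ := hz.exists_coverClass
  have hdisj : Disjoint (P.edgeSet Q) (P.edgeSet Q') := Set.disjoint_iff_inter_eq_empty.2 h1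
  have hne : P.edgeSet Q ≠ P.edgeSet Q' := fun heq =>
    Set.disjoint_left.1 hdisj he (heq ▸ he)
  -- Both edge sets contain a class ending at `x`, so their union is a tube and therefore a block.
  refine hN.union_notMem {P.edgeSet Q, P.edgeSet Q'} ?_ (Set.toFinite _)
    (Set.nontrivial_pair hne) ?_ ?_
  · rintro B (rfl | rfl) <;> assumption
  · exact Set.pairwise_pair.2 fun _ => ⟨hdisj, hdisj.symm⟩
  · rw [Set.sUnion_pair]
    exact mem_blocks_of_mem_graphTubes (union_mem_graphTubes hQ.edgeSet_mem_graphTubes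
      hQ'.edgeSet_mem_graphTubes he hf hey hfz)

/-- Contracting all edge sets of a strongly connected component `W` would merge its pipes into one
class. But a pipe of `W` with maximal edge set is a full component of the union, so no arc of a
cycle can leave it. -/
theorem inducesAcyclic_of_isAcyclicFamily (hN : P.orBuildingSet.building.IsNested N)
    (hA : P.orBuildingSet.matroid.IsAcyclicFamily N) :
    P.InducesAcyclic {Q | P.IsPipe Q ∧ P.edgeSet Q ∈ N} := by
  intro Q₀ hQ₀
  set r : Set ℤ → Set ℤ → Prop := fun R R' => R ∈ {Q | P.IsPipe Q ∧ P.edgeSet Q ∈ N} ∧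
    R' ∈ {Q | P.IsPipe Q ∧ P.edgeSet Q ∈ N} ∧ P.Arc R R' with hr
  -- the strongly connected component of `Q₀`
  set W : Set (Set ℤ) := {R | Relation.TransGen r Q₀ R ∧ Relation.TransGen r R Q₀} with hW
  have hWpipe : ∀ R ∈ W, P.IsPipe R ∧ P.edgeSet R ∈ N := by
    rintro R ⟨-, hR⟩
    obtain ⟨R', h, -⟩ := Relation.TransGen.head'_iff.1 hR
    exact h.1
  obtain ⟨B, hB⟩ := (Set.toFinite (P.edgeSet '' W)).exists_maximal
    ⟨_, Q₀, ⟨hQ₀, hQ₀⟩, rfl⟩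
  obtain ⟨⟨R, hR, rfl⟩, hmax⟩ := hB
  set S := ⋃₀ (P.edgeSet '' W) with hS
  have hsub : ∀ R ∈ W, P.edgeSet R ⊆ S := fun R hR => Set.subset_sUnion_of_mem ⟨R, hR, rfl⟩
  -- `R` is a component of `S`
  have hcomp : ∀ x ∈ R, ∀ y, P.Conn S x y → y ∈ R := by
    intro x hx y h
    induction h with
    | refl => exact hx
    | @tail y z _ h ih =>
      obtain ⟨e, ⟨_, ⟨R', hR', rfl⟩, he⟩, hl⟩ := h.exists_coverClass
      have hl' : P.Link (P.edgeSet R') y z := hl.mono (Set.singleton_subset_iff.2 he)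
      obtain ⟨k, hy, -⟩ := exists_mem_shiftSet_of_link hl'
      have hle := edgeSet_subset_or_subset hN (hWpipe R hR).1 ((hWpipe R' hR').1.shift k)
        (hWpipe R hR).2 (by rw [edgeSet_shiftSet]; exact (hWpipe R' hR').2) ih hy
      rw [edgeSet_shiftSet] at hle
      have hle' : P.edgeSet R' ⊆ P.edgeSet R := hle.elim (fun h => hmax ⟨R', hR', rfl⟩ h) id
      exact (hWpipe R hR).1.mem_of_link ih (hl'.mono hle')
  have hRR : Relation.TransGen r R R := hR.2.trans hR.1
  obtain ⟨R₂, hRR₂, hR₂R⟩ := Relation.TransGen.head'_iff.1 hRR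
  have hpath : ∀ {R'}, Relation.ReflTransGen r R' R → R' ∈ W →
      ∀ x ∈ R', ∀ y ∈ R, P.PreLe S x y := by
    intro R' h
    induction h using Relation.ReflTransGen.head_induction_on with
    | refl => exact fun hR' x hx y hy =>
        (((hWpipe R hR').1.conn hx hy).mono (hsub R hR')).preLe
    | @head R' R'' h h' ih =>
      intro hR' x hx y hy
      have hR'' : R'' ∈ W := ⟨hR'.1.tail h, Relation.TransGen.trans_right h' hR.2⟩
      obtain ⟨-, q, hq, q', hq', hlt⟩ := h.2.2
      exact ((((hWpipe R' hR').1.conn hx hq).mono (hsub R' hR')).preLe.trans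
        (preLe_of_le hlt.1)).trans (ih hR'' q' hq' y hy)
  have hR₂ : R₂ ∈ W := ⟨hR.1.tail hRR₂, Relation.TransGen.trans_right hR₂R hR.2⟩
  obtain ⟨hdisj, q, hq, q', hq', hlt⟩ := hRR₂.2.2
  -- The rest of the cycle leads from `q'` back to `q` in the contracted preorder. The full set is
  -- treated apart, since it is not contractible but connects all integers.
  have hqq' : P.Conn S q q' := by
    by_cases hne : S = Set.univ
    · rw [hne]
      exact conn_univ q q'
    · have hface := (isAcyclicFamily_configMatroid_iff _ _).1 hA (P.edgeSet '' W) (by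
        rintro _ ⟨R', hR', rfl⟩
        exact (hWpipe R' hR').2)
      exact (isContractible_of_isConfigFace hne hface).conn_of_preLe _ _ (preLe_of_le hlt.1)
        (hpath hR₂R hR₂ q' hq' q hq)
  exact (Set.disjoint_iff_inter_eq_empty.2 hdisj).le_bot ⟨hcomp q hq q' hqq', hq'⟩

theorem exists_isPiping (hN : P.orBuildingSet.building.IsNested N)
    (hA : P.orBuildingSet.matroid.IsAcyclicFamily N) :
    ∃ T, P.IsPiping T ∧ P.classEdgeSet '' T = N := by
  refine ⟨{C | P.IsPipeClass C ∧ P.classEdgeSet C ∈ N}, ⟨fun C hC => hC.1, ?_, ?_, ?_⟩, ?_⟩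
  · refine ⟨⟨_, isPipe_univ, rfl⟩, ?_⟩
    rw [classEdgeSet_univ]
    exact hN.components_subset (components_orBuildingSet.symm ▸ rfl)
  · rintro _ ⟨⟨Q, hQ, rfl⟩, hC⟩ _ ⟨⟨Q', hQ', rfl⟩, hC'⟩
    rw [classEdgeSet_subsetClass] at hC hC'
    rw [or_iff_not_imp_right]
    intro hdisj
    simp only [ClassDisjoint, not_forall, ← ne_eq, ← Set.nonempty_iff_ne_empty] at hdisj
    obtain ⟨R, hR, R', hR', x, hx, hx'⟩ := hdisj
    have h1 := edgeSet_eq_of_mem (P := P) hR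
    have h2 := edgeSet_eq_of_mem (P := P) hR'
    rcases edgeSet_subset_or_subset hN (hQ.of_mem hR) (hQ'.of_mem hR') (h1 ▸ hC) (h2 ▸ hC') hx hx'
      with h | h
    · exact ⟨R, hR, R', hR', .inl ((hQ.of_mem hR).subset_of_mem (hQ'.of_mem hR') h hx hx')⟩
    · exact ⟨R, hR, R', hR', .inr ((hQ'.of_mem hR').subset_of_mem (hQ.of_mem hR) h hx' hx)⟩
  · intro Q hQ
    have hmem : ⋃₀ {C | P.IsPipeClass C ∧ P.classEdgeSet C ∈ N} ⊆
        {Q | P.IsPipe Q ∧ P.edgeSet Q ∈ N} := by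
      rintro R ⟨C, ⟨hC, hC'⟩, hR⟩
      rw [subsetClass_eq_of_isPipeClass hC hR, classEdgeSet_subsetClass] at hC'
      exact ⟨isPipe_of_isPipeClass hC hR, hC'⟩
    exact inducesAcyclic_of_isAcyclicFamily hN hA Q
      (Relation.TransGen.mono (fun R R' h => ⟨hmem h.1, hmem h.2.1, h.2.2⟩) _ _ hQ)
  · ext B
    constructor
    · rintro ⟨C, hC, rfl⟩
      exact hC.2
    · intro hB
      obtain ⟨Q, hQ, rfl⟩ := exists_isPipe_of_mem hN hA hB
      exact ⟨subsetClass n Q, ⟨⟨Q, hQ, rfl⟩, by rwa [classEdgeSet_subsetClass]⟩,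
        classEdgeSet_subsetClass Q⟩

end OfNested

end AffinePoset

namespace AffinePoset

variable {n : ℕ} {P : AffinePoset n} {S : Set P.CoverClass} {Q Q' : Set ℤ}

/-! ## From pipings to acyclic nested sets -/

namespace IsPiping

variable {T : Set (Set (Set ℤ))} {M : Set (Set P.CoverClass)}

theorem edgeSet_subset_or_subset_or_disjoint (hT : P.IsPiping T) {C C' : Set (Set ℤ)} (hC : C ∈ T)
    (hC' : C' ∈ T) : P.classEdgeSet C ⊆ P.classEdgeSet C' ∨
      P.classEdgeSet C' ⊆ P.classEdgeSet C ∨ ClassDisjoint C C' := by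
  rcases hT.nested_or_disjoint C hC C' hC' with ⟨Q, hQ, Q', hQ', h⟩ | h
  · rw [subsetClass_eq_of_isPipeClass (hT.isPipeClass C hC) hQ,
      subsetClass_eq_of_isPipeClass (hT.isPipeClass C' hC') hQ', classEdgeSet_subsetClass,
      classEdgeSet_subsetClass]
    exact h.elim (fun h => .inl (edgeSet_mono h)) fun h => .inr (.inl (edgeSet_mono h))
  · exact .inr (.inr h)

theorem disjoint_classEdgeSet (hT : P.IsPiping T) {C C' : Set (Set ℤ)} (hC' : C' ∈ T)
    (h : ClassDisjoint C C') : Disjoint (P.classEdgeSet C) (P.classEdgeSet C') := by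
  rw [Set.disjoint_left]
  rintro _ ⟨Q, hQ, i, j, hij, hi, -, rfl⟩ ⟨Q', hQ', i', j', hij', hi', -, he⟩
  obtain ⟨k, rfl, -⟩ := (P.coverClass_eq_iff _ _).1 he
  refine (Set.disjoint_iff_inter_eq_empty.2 (h Q hQ (shiftSet n k Q') ?_)).le_bot
    ⟨hi, i', hi', rfl⟩
  rw [subsetClass_eq_of_isPipeClass (hT.isPipeClass C' hC') hQ']
  exact ⟨k, rfl⟩

/-- The pipes of a piping whose sets of cover relation classes are in `M`. -/
def pipesOver (P : AffinePoset n) (T : Set (Set (Set ℤ))) (M : Set (Set P.CoverClass)) :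
    Set (Set ℤ) :=
  {Q | Q ∈ ⋃₀ T ∧ P.edgeSet Q ∈ M}

theorem isPipe (hT : P.IsPiping T) (hQ : Q ∈ ⋃₀ T) : P.IsPipe Q := by
  obtain ⟨C, hC, hQ⟩ := hQ
  exact isPipe_of_isPipeClass (hT.isPipeClass C hC) hQ

theorem shift_mem_pipesOver (hT : P.IsPiping T) (hQ : Q ∈ pipesOver P T M) (k : ℤ) :
    shiftSet n k Q ∈ pipesOver P T M := by
  obtain ⟨⟨C, hC, hQC⟩, hM⟩ := hQ
  refine ⟨⟨C, hC, ?_⟩, by rwa [edgeSet_shiftSet]⟩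
  rw [subsetClass_eq_of_isPipeClass (hT.isPipeClass C hC) hQC]
  exact ⟨k, rfl⟩

theorem exists_mem_pipesOver (hT : P.IsPiping T) (hM : M ⊆ P.classEdgeSet '' T)
    {B : Set P.CoverClass} (hB : B ∈ M) : ∃ Q ∈ pipesOver P T M, P.edgeSet Q = B := by
  obtain ⟨C, hC, rfl⟩ := hM hB
  obtain ⟨Q, hQ, rfl⟩ := hT.isPipeClass C hC
  rw [classEdgeSet_subsetClass] at hB ⊢
  exact ⟨Q, ⟨⟨_, hC, mem_subsetClass_self⟩, hB⟩, rfl⟩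

/-- Distinct members of `M` are disjoint and nonempty, which excludes nesting; disjoint classes
cannot share `x`. So the edge sets agree, and touching pipes with equal edge sets coincide. -/
theorem eq_of_mem_pipesOver (hT : P.IsPiping T) (hd : M.PairwiseDisjoint id)
    (hQ : Q ∈ pipesOver P T M) (hQ' : Q' ∈ pipesOver P T M) {x : ℤ} (hx : x ∈ Q) (hx' : x ∈ Q') :
    Q = Q' := by
  have hp := hT.isPipe hQ.1
  have hp' := hT.isPipe hQ'.1
  refine hp.eq_of_mem hp' ?_ hx hx'
  obtain ⟨⟨C, hC, hQC⟩, hM⟩ := hQ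
  obtain ⟨⟨C', hC', hQC'⟩, hM'⟩ := hQ'
  have h := hT.edgeSet_subset_or_subset_or_disjoint hC hC'
  have hCC : P.classEdgeSet C = P.edgeSet Q := by
    rw [subsetClass_eq_of_isPipeClass (hT.isPipeClass C hC) hQC, classEdgeSet_subsetClass]
  have hCC' : P.classEdgeSet C' = P.edgeSet Q' := by
    rw [subsetClass_eq_of_isPipeClass (hT.isPipeClass C' hC') hQC', classEdgeSet_subsetClass]
  rw [hCC, hCC'] at h
  by_contra hne
  have hdisj := Set.disjoint_left.1 (hd hM hM' hne)
  rcases h with h | h | h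
  · obtain ⟨e, he⟩ := hp.edgeSet_nonempty
    exact hdisj he (h he)
  · obtain ⟨e, he⟩ := hp'.edgeSet_nonempty
    exact hdisj (h he) he
  · exact (Set.disjoint_iff_inter_eq_empty.2 (h Q hQC Q' hQC')).le_bot ⟨hx, hx'⟩

theorem exists_mem_pipesOver_of_link (hT : P.IsPiping T) (hM : M ⊆ P.classEdgeSet '' T) {x y : ℤ}
    (h : P.Link (⋃₀ M) x y) : ∃ Q ∈ pipesOver P T M, x ∈ Q ∧ y ∈ Q := by
  obtain ⟨e, ⟨B, hB, he⟩, hl⟩ := h.exists_coverClass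
  obtain ⟨Q, hQ, rfl⟩ := hT.exists_mem_pipesOver hM hB
  obtain ⟨k, hk⟩ := exists_mem_shiftSet_of_link (hl.mono (Set.singleton_subset_iff.2 he))
  exact ⟨_, hT.shift_mem_pipesOver hQ k, hk⟩

theorem mem_of_conn (hT : P.IsPiping T) (hM : M ⊆ P.classEdgeSet '' T)
    (hd : M.PairwiseDisjoint id) (hQ : Q ∈ pipesOver P T M) {x y : ℤ} (hx : x ∈ Q)
    (h : P.Conn (⋃₀ M) x y) : y ∈ Q := by
  induction h with
  | refl => exact hx
  | tail _ h ih =>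
    obtain ⟨R, hR, hy, hz⟩ := hT.exists_mem_pipesOver_of_link hM h
    rwa [hT.eq_of_mem_pipesOver hd hQ hR ih hy]

/-- The arcs between the pipes over `M`. -/
def ArcOver (P : AffinePoset n) (T : Set (Set (Set ℤ))) (M : Set (Set P.CoverClass))
    (Q Q' : Set ℤ) : Prop :=
  Q ∈ pipesOver P T M ∧ Q' ∈ pipesOver P T M ∧ P.Arc Q Q'

theorem reflTransGen_of_le (hT : P.IsPiping T) (hd : M.PairwiseDisjoint id)
    (hQ : Q ∈ pipesOver P T M) (hQ' : Q' ∈ pipesOver P T M) {q q' : ℤ} (hq : q ∈ Q) (hq' : q' ∈ Q')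
    (h : P.le q q') : Relation.ReflTransGen (ArcOver P T M) Q Q' := by
  by_cases hne : Q = Q'
  · rw [hne]
  · have hdisj : Q ∩ Q' = ∅ := by
      by_contra hcon
      obtain ⟨x, hx, hx'⟩ := Set.nonempty_iff_ne_empty.2 hcon
      exact hne (hT.eq_of_mem_pipesOver hd hQ hQ' hx hx')
    refine .single ⟨hQ, hQ', hdisj, q, hq, q', hq', h, ?_⟩
    rintro rfl
    exact (Set.disjoint_iff_inter_eq_empty.2 hdisj).le_bot ⟨hq, hq'⟩

theorem eq_of_reflTransGen (hT : P.IsPiping T)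
    (h : Relation.ReflTransGen (ArcOver P T M) Q Q')
    (h' : Relation.ReflTransGen (ArcOver P T M) Q' Q) : Q = Q' := by
  rcases Relation.reflTransGen_iff_eq_or_transGen.1 h with h | h
  · exact h.symm
  · exact absurd (Relation.TransGen.mono (fun R R' h => ⟨h.1.1, h.2.1.1, h.2.2⟩) _ _
      (h.trans_left h')) (hT.acyclic Q)

/-- A normal form for walks in the contraction: either no pipe is used, or the walk climbs to a
first pipe, follows arcs to a last one, and climbs to its end. -/
theorem le_or_exists_of_preLe (hT : P.IsPiping T) (hM : M ⊆ P.classEdgeSet '' T)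
    (hd : M.PairwiseDisjoint id) {x y : ℤ} (h : P.PreLe (⋃₀ M) x y) :
    P.le x y ∨ ∃ Q ∈ pipesOver P T M, ∃ Q' ∈ pipesOver P T M, ∃ q ∈ Q, ∃ q' ∈ Q',
      P.le x q ∧ Relation.ReflTransGen (ArcOver P T M) Q Q' ∧ P.le q' y := by
  induction h with
  | refl => exact .inl (P.refl x)
  | tail _ h ih =>
    rcases h with h | h
    · rcases ih with ih | ⟨Q, hQ, Q', hQ', q, hq, q', hq', h1, h2, h3⟩
      · exact .inl (P.trans _ _ _ ih h.1.1)
      · exact .inr ⟨Q, hQ, Q', hQ', q, hq, q', hq', h1, h2, P.trans _ _ _ h3 h.1.1⟩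
    · obtain ⟨R, hR, hy, hz⟩ := hT.exists_mem_pipesOver_of_link hM h
      right
      rcases ih with ih | ⟨Q, hQ, Q', hQ', q, hq, q', hq', h1, h2, h3⟩
      · exact ⟨R, hR, R, hR, _, hy, _, hz, ih, .refl, P.refl _⟩
      · exact ⟨Q, hQ, R, hR, q, hq, _, hz, h1,
          h2.trans (hT.reflTransGen_of_le hd hQ' hR hq' hy h3), P.refl _⟩

/-- Pipes of a piping are convex for the preorder obtained by contracting pipes. -/
theorem mem_of_preLe (hT : P.IsPiping T) (hM : M ⊆ P.classEdgeSet '' T)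
    (hd : M.PairwiseDisjoint id) (hQ : Q ∈ pipesOver P T M) {q q' x : ℤ} (hq : q ∈ Q) (hq' : q' ∈ Q)
    (h : P.PreLe (⋃₀ M) q x) (h' : P.PreLe (⋃₀ M) x q') : x ∈ Q := by
  have h1 : ∃ V ∈ pipesOver P T M, ∃ v ∈ V, P.le v x ∧
      Relation.ReflTransGen (ArcOver P T M) Q V := by
    rcases hT.le_or_exists_of_preLe hM hd h with h | ⟨U, hU, V, hV, u, hu, v, hv, h1, h2, h3⟩
    · exact ⟨Q, hQ, q, hq, h, .refl⟩
    · exact ⟨V, hV, v, hv, h3, (hT.reflTransGen_of_le hd hQ hU hq hu h1).trans h2⟩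
  have h2 : ∃ U ∈ pipesOver P T M, ∃ u ∈ U, P.le x u ∧
      Relation.ReflTransGen (ArcOver P T M) U Q := by
    rcases hT.le_or_exists_of_preLe hM hd h' with h | ⟨U, hU, V, hV, u, hu, v, hv, h1, h2, h3⟩
    · exact ⟨Q, hQ, q', hq', h, .refl⟩
    · exact ⟨U, hU, u, hu, h1, h2.trans (hT.reflTransGen_of_le hd hV hQ hv hq' h3)⟩
  obtain ⟨V, hV, v, hv, hvx, hQV⟩ := h1
  obtain ⟨U, hU, u, hu, hxu, hUQ⟩ := h2
  -- Since `v ≤ x ≤ u`, the pipes `Q`, `V`, `U` lie on a closed walk of arcs. Acyclicity makes them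
  -- equal, and order convexity gives `x ∈ Q`.
  have hVU := hT.reflTransGen_of_le hd hV hU hv hu (P.trans _ _ _ hvx hxu)
  obtain rfl := hT.eq_of_reflTransGen hQV (hVU.trans hUQ)
  obtain rfl := hT.eq_of_reflTransGen hVU hUQ
  exact (hT.isPipe hQ.1).2.1 _ _ _ hvx hxu hv hu

/-- If `x` and `y` lie below each other and both walks avoid pipes, antisymmetry applies. Otherwise
some walk meets a pipe at a point equivalent to both, and `mem_of_preLe` puts both in that pipe. The
other two conditions hold because components with a link are pipes different from `ℤ`, hence thin.
-/
theorem isContractible (hT : P.IsPiping T) (hM : M ⊆ P.classEdgeSet '' T)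
    (hd : M.PairwiseDisjoint id) (huniv : Set.univ ∉ M) : P.IsContractible (⋃₀ M) where
  conn_of_preLe x y hxy hyx := by
    have hconn : ∀ {Q}, Q ∈ pipesOver P T M → x ∈ Q → y ∈ Q → P.Conn (⋃₀ M) x y :=
      fun hQ hx hy => ((hT.isPipe hQ.1).conn hx hy).mono (Set.subset_sUnion_of_mem hQ.2)
    have key : ∀ Q ∈ pipesOver P T M, ∀ q ∈ Q, P.PreLe (⋃₀ M) x q → P.PreLe (⋃₀ M) q x →
        P.Conn (⋃₀ M) x y := fun Q hQ q hq h1 h2 =>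
      hconn hQ (hT.mem_of_preLe hM hd hQ hq hq h2 h1)
        (hT.mem_of_preLe hM hd hQ hq hq (h2.trans hxy) (hyx.trans h1))
    have hreach : ∀ {U V : Set ℤ}, Relation.ReflTransGen (ArcOver P T M) U V →
        ∀ u ∈ U, ∀ v ∈ V, V ∈ pipesOver P T M → P.PreLe (⋃₀ M) u v := by
      intro U V h u hu
      have hin : ∀ {R : Set ℤ}, R ∈ pipesOver P T M → ∀ a ∈ R, ∀ b ∈ R, P.PreLe (⋃₀ M) a b :=
        fun hR a ha b hb =>
          (((hT.isPipe hR.1).conn ha hb).mono (Set.subset_sUnion_of_mem hR.2)).preLe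
      induction h with
      | refl => exact fun v hv hV => hin hV u hu v hv
      | tail _ h ih =>
        intro v hv hV
        obtain ⟨hR, -, -, a, ha, b, hb, hab⟩ := h
        exact ((ih a ha hR).trans (preLe_of_le hab.1)).trans (hin hV b hb v hv)
    rcases hT.le_or_exists_of_preLe hM hd hxy with h | ⟨U, hU, V, hV, u, hu, v, hv, h1, h2, h3⟩
    · rcases hT.le_or_exists_of_preLe hM hd hyx with
        h' | ⟨U, hU, V, hV, u, hu, v, hv, h1, h2, h3⟩
      · rw [P.antisymm _ _ h h']
        exact .refl
      · exact key U hU u hu (hxy.trans (preLe_of_le h1))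
          ((hreach h2 u hu v hv hV).trans (preLe_of_le h3))
    · exact key U hU u hu (preLe_of_le h1)
        (((hreach h2 u hu v hv hV).trans (preLe_of_le h3)).trans hyx)
  eq_zero_of_conn x k h := by
    have hn := P.n_pos
    rcases h.cases_head with h' | ⟨z, h', -⟩
    · have : k * n = 0 := by linarith
      rcases mul_eq_zero.1 this with h | h <;> omega
    · obtain ⟨Q, hQ, hx, -⟩ := hT.exists_mem_pipesOver_of_link hM h'
      refine IsThin.eq_zero (hT.isPipe hQ.1).1 ?_ P.one_le hx (hT.mem_of_conn hM hd hQ hx h)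
      rintro rfl
      exact huniv (edgeSet_univ (P := P) ▸ hQ.2)
  coverClass_mem i j hij h := by
    rcases h.cases_head with h' | ⟨z, h', -⟩
    · exact absurd h' hij.1.2
    · obtain ⟨Q, hQ, hi, -⟩ := hT.exists_mem_pipesOver_of_link hM h'
      exact ⟨_, hQ.2, i, j, hij, hi, hT.mem_of_conn hM hd hQ hi h, rfl⟩

theorem isAcyclicFamily (hT : P.IsPiping T) :
    P.orBuildingSet.matroid.IsAcyclicFamily (P.classEdgeSet '' T) := by
  refine (isAcyclicFamily_configMatroid_iff _ _).2 fun N' hN' => ?_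
  by_cases huniv : Set.univ ∈ N'
  · rw [Set.eq_univ_of_univ_subset (Set.subset_sUnion_of_mem huniv)]
    exact isConfigFace_univ
  -- The maximal members have the same union and, unlike `N'` itself, are pairwise disjoint.
  let M := {B | Maximal (· ∈ N') B}
  have hMN : M ⊆ N' := fun B hB => hB.1
  have hU : ⋃₀ N' = ⋃₀ M := by
    refine Set.Subset.antisymm (Set.sUnion_subset fun B hB => ?_) (Set.sUnion_subset_sUnion hMN)
    obtain ⟨B', h, hB'⟩ := (Set.toFinite N').exists_le_maximal hB
    exact h.trans (Set.subset_sUnion_of_mem hB')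
  rw [hU]
  refine (hT.isContractible (hMN.trans hN') ?_ fun h => huniv (hMN h)).isConfigFace
  intro B hB B' hB' hne
  obtain ⟨C, hC, rfl⟩ := hN' (hMN hB)
  obtain ⟨C', hC', rfl⟩ := hN' (hMN hB')
  rcases hT.edgeSet_subset_or_subset_or_disjoint hC hC' with h | h | h
  · exact absurd (hB.eq_of_le hB'.1 h) hne
  · exact absurd (hB'.eq_of_le hB.1 h).symm hne
  · exact hT.disjoint_classEdgeSet hC' h

theorem isNested (hT : P.IsPiping T) : P.orBuildingSet.building.IsNested (P.classEdgeSet '' T) where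
  subset_blocks := by
    rintro _ ⟨C, hC, rfl⟩
    obtain ⟨Q, hQ, rfl⟩ := hT.isPipeClass C hC
    rw [classEdgeSet_subsetClass]
    exact mem_blocks_of_mem_graphTubes hQ.edgeSet_mem_graphTubes
  components_subset := by
    rw [components_orBuildingSet, Set.singleton_subset_iff]
    exact ⟨_, hT.univ_mem, classEdgeSet_univ⟩
  nested_or_disjoint := by
    rintro _ ⟨C, hC, rfl⟩ _ ⟨C', hC', rfl⟩
    refine (hT.edgeSet_subset_or_subset_or_disjoint hC hC').imp_right (Or.imp_right fun h => ?_)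
    exact Set.disjoint_iff_inter_eq_empty.1 (hT.disjoint_classEdgeSet hC' h)
  union_notMem M hM _ hnt hd hblock := by
    obtain ⟨B, hB, B', hB', hne⟩ := hnt
    have hbal : ¬ P.IsUnbalanced (⋃₀ M) := by
      -- A member equal to `univ` would be the only one, as the others are nonempty and disjoint
      -- from it.
      refine (hT.isContractible hM hd fun huniv => ?_).not_isUnbalanced
      have hempty : ∀ B ∈ M, B = Set.univ := fun B hB => by
        by_contra hne
        obtain ⟨Q, hQ, rfl⟩ := hT.exists_mem_pipesOver hM hB
        obtain ⟨e, he⟩ := (hT.isPipe hQ.1).edgeSet_nonempty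
        exact Set.disjoint_left.1 (hd hB huniv hne) he trivial
      exact hne ((hempty B hB).trans (hempty B' hB').symm)
    have htube := (mem_graphTubes_or_isUnbalanced hblock).resolve_right hbal
    obtain ⟨Q, hQ, rfl⟩ := hT.exists_mem_pipesOver hM hB
    obtain ⟨Q', hQ', rfl⟩ := hT.exists_mem_pipesOver hM hB'
    obtain ⟨x, hx⟩ := (hT.isPipe hQ.1).2.2.2.nonempty
    obtain ⟨y, hxy⟩ := (hT.isPipe hQ.1).exists_link hx
    obtain ⟨e, he, hl⟩ := hxy.exists_coverClass
    obtain ⟨x', hx'⟩ := (hT.isPipe hQ'.1).2.2.2.nonempty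
    obtain ⟨y', hxy'⟩ := (hT.isPipe hQ'.1).exists_link hx'
    obtain ⟨e', he', hl'⟩ := hxy'.exists_coverClass
    -- Were the union a tube, `Q` would be connected to a translate of `Q'`. Pipes over `M` are
    -- closed under connection, so the two would be equal and so would their edge sets.
    obtain ⟨k, hk⟩ := exists_conn_of_mem_graphTubes htube ⟨_, hB, he⟩ ⟨_, hB', he'⟩ hl hl'
    have := hT.eq_of_mem_pipesOver hd hQ (hT.shift_mem_pipesOver hQ' k)
      (hT.mem_of_conn hM hd hQ hx hk) ⟨x', hx', rfl⟩
    exact hne (by rw [this, edgeSet_shiftSet])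

end IsPiping

end AffinePoset

/-! ## The isomorphism -/

theorem SimpComplex.exists_mem_vertices {V : Type*} {K : SimpComplex V} {s : Finset V}
    (hs : s ∈ K.faces) {v : V} (hv : v ∈ s) : v ∈ K.vertices :=
  K.down_closed hs (Finset.singleton_subset_iff.2 hv)

/-- A map that is injective on vertices and under which images of faces are faces and every face is
the image of a face yields an isomorphism. -/
theorem SimpComplex.nonempty_iso_of_image {V W : Type*} {K : SimpComplex V} {L : SimpComplex W}
    (φ : V → W) (hinj : Set.InjOn φ K.vertices)
    (himage : ∀ s ∈ K.faces, ∃ t ∈ L.faces, (t : Set W) = φ '' s)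
    (hsurj : ∀ t ∈ L.faces, ∃ s ∈ K.faces, (t : Set W) = φ '' s) :
    Nonempty (K.Iso L) := by
  have hφ : ∀ v ∈ K.vertices, φ v ∈ L.vertices := by
    intro v hv
    obtain ⟨t, ht, htv⟩ := himage _ hv
    refine SimpComplex.exists_mem_vertices ht ?_
    rw [← Finset.mem_coe, htv]
    exact ⟨v, by simp, rfl⟩
  let f : K.vertices → L.vertices := fun v => ⟨φ v, hφ v v.2⟩
  have hf : Function.Bijective f := by
    refine ⟨fun v v' h => Subtype.ext (hinj v.2 v'.2 (congrArg Subtype.val h)), fun ⟨w, hw⟩ => ?_⟩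
    obtain ⟨s, hs, hsw⟩ := hsurj _ hw
    have : w ∈ φ '' s := hsw ▸ Finset.mem_coe.2 (Finset.mem_singleton_self w)
    obtain ⟨v, hv, rfl⟩ := this
    exact ⟨⟨v, SimpComplex.exists_mem_vertices hs hv⟩, rfl⟩
  refine ⟨⟨Equiv.ofBijective f hf, fun s => ?_⟩⟩
  have hcoe : (((s.map (Equiv.ofBijective f hf).toEmbedding).map
      (Function.Embedding.subtype _) : Finset W) : Set W) =
      φ '' (s.map (Function.Embedding.subtype _) : Finset V) := by
    ext w
    simp only [Finset.coe_map, Set.image_image]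
    rfl
  constructor
  · intro hs
    obtain ⟨t, ht, hts⟩ := himage _ hs
    rw [← hcoe] at hts
    rwa [← Finset.coe_injective hts]
  · intro hs
    obtain ⟨s', hs', h⟩ := hsurj _ hs
    rw [hcoe] at h
    have := (hinj.image_eq_image_iff (fun v hv => ?_)
      fun v hv => SimpComplex.exists_mem_vertices hs' hv).1 h
    · rwa [Finset.coe_injective this]
    · obtain ⟨v, -, rfl⟩ := Finset.mem_map.1 (Finset.mem_coe.1 hv)
      exact v.2

namespace AffinePoset

variable {n : ℕ} {P : AffinePoset n}

theorem isPipeClass_of_mem_vertices {C : Set (Set ℤ)} (hC : C ∈ P.pipingComplex.vertices) :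
    P.IsPipeClass C := by
  obtain ⟨T, hT, h⟩ := hC
  have : C ∈ T \ {subsetClass n Set.univ} := h ▸ Finset.mem_coe.2 (Finset.mem_singleton_self C)
  exact hT.isPipeClass C this.1

theorem IsPiping.injOn_classEdgeSet {T : Set (Set (Set ℤ))} (hT : P.IsPiping T) :
    Set.InjOn P.classEdgeSet T := classEdgeSet_injOn.mono hT.isPipeClass

theorem IsPiping.image_sdiff {T : Set (Set (Set ℤ))} (hT : P.IsPiping T) :
    P.classEdgeSet '' (T \ {subsetClass n Set.univ}) =
      P.classEdgeSet '' T \ P.orBuildingSet.building.components := by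
  rw [components_orBuildingSet, hT.injOn_classEdgeSet.image_sdiff_subset
    (Set.singleton_subset_iff.2 hT.univ_mem), Set.image_singleton, classEdgeSet_univ]

end AffinePoset

theorem mainTheorem10 (n : ℕ) (P : AffinePoset n) :
    Nonempty (SimpComplex.Iso P.pipingComplex P.orBuildingSet.acyclicNestedComplex) := by
  classical
  refine SimpComplex.nonempty_iso_of_image P.classEdgeSet
    (AffinePoset.classEdgeSet_injOn.mono fun C => AffinePoset.isPipeClass_of_mem_vertices) ?_ ?_
  · rintro s ⟨T, hT, hs⟩
    refine ⟨s.image P.classEdgeSet, ⟨_, hT.isNested, hT.isAcyclicFamily, ?_⟩, Finset.coe_image⟩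
    rw [Finset.coe_image, hs, hT.image_sdiff]
  · rintro t ⟨N, hN, hA, ht⟩
    obtain ⟨T, hT, rfl⟩ := AffinePoset.exists_isPiping hN hA
    rw [← hT.image_sdiff] at ht
    -- Pipings are arbitrary sets; finiteness is pulled back from `t` along the injection.
    have hfin : (T \ {subsetClass n Set.univ}).Finite :=
      Set.Finite.of_finite_image (ht ▸ t.finite_toSet)
        (hT.injOn_classEdgeSet.mono Set.sdiff_subset)
    exact ⟨hfin.toFinset, ⟨T, hT, hfin.coe_toFinset⟩, by rw [ht, hfin.coe_toFinset]⟩
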